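/- Let $n\ge 1$ be an integer, let $0<d<n$ be real, and let $\sigma$ denote $d$-dimensional Hausdorff measure on $\mathbb{R}^n$. Let $\Omega\subseteq\mathbb{R}^n$ be open with nonempty boundary, write $\delta(y)=\operatorname{dist}(y,\partial\Omega)$, and suppose that the complement $\mathbb{R}^n\setminus\Omega$ is unbounded and that $\Omega$ is a weak local John domain with $d$-Ahlfors regular boundary, that is: (i) there is $A>0$ such that $\frac1A r^d\le\sigma(B(\xi,r)\cap\partial\Omega)\le A r^d$ for all $\xi\in\partial\Omega$ and all real $r$ with $0<r\le\operatorname{diam}\partial\Omega$; (ii) there are $\theta,\lambda\in(0,1]$ and $N\ge 2$ such that for every $y\in\Omega$ there is a Borel set $F\subseteq B(y,N\delta(y))\cap\partial\Omega$ with $\sigma(F)\ge\theta\,\sigma(B(y,N\delta(y))\cap\partial\Omega)$ such that every $x\in F$ is joined to $y$ by a $\lambda$-carrot path, i.e. a rectifiable path $\zeta:[0,T]\to\Omega\cup\{x\}$, continuous and parameterized by arc length, with $\zeta(0)=x$, $\zeta(T)=y$ and $\delta(\zeta(t))\ge\lambda t$ for all $t\in[0,T]$. Let $0<c<1$, $s>0$,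 $1\le p<\infty$ and $1\le\beta<\infty$. For $f\in L^\beta_{loc}(\Omega)$ (scalar- or vector-valued) and $t\in\mathbb{R}$ put $$\|f\|_{L^p_{av,c,\beta,t}(\Omega)}=\biggl(\int_\Omega\Bigl(\frac{1}{|B(y,c\delta(y))|}\int_{B(y,c\delta(y))}|f|^\beta\Bigr)^{p/\beta}\delta(y)^{d-n+p-pt}\,dy\biggr)^{1/p},$$ and let $\widetilde W^{1,p}_{av,c,\beta,s}(\Omega)$ be the space of all $u:\Omega\to\mathbb{R}$ in $L^\beta_{loc}(\Omega)$ with weak gradient $\nabla u\in L^\beta_{loc}(\Omega)$ for which $$\|u\|_{\widetilde W^{1,p}_{av,c,\beta,s}(\Omega)}=\|\nabla u\|_{L^p_{av,c,\beta,s}(\Omega)}+\|u\|_{L^p_{av,c,\beta,s+1}(\Omega)}<\infty .$$ Then $C_0^\infty(\Omega)$, the space of smooth functions with compact support in $\Omega$, is contained and dense in $\widetilde W^{1,p}_{av,c,\beta,s}(\Omega)$: every $\varphi\in C_0^\infty(\Omega)$ lies in $\widetilde W^{1,p}_{av,c,\beta,s}(\Omega)$, and for every $u\in\widetilde W^{1,p}_{av,c,\beta,s}(\Omega)$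 and every $\varepsilon>0$ there is $\varphi\in C_0^\infty(\Omega)$ with $\|u-\varphi\|_{\widetilde W^{1,p}_{av,c,\beta,s}(\Omega)}<\varepsilon$. -/

import Mathlib

open MeasureTheory Set
open scoped ENNReal ContDiff

noncomputable section

namespace AveragedSobolev

/-- Euclidean space `ℝⁿ`. -/
abbrev E (n : ℕ) : Type := EuclideanSpace ℝ (Fin n)

/-! ### Geometry: Ahlfors regularity and weak local John domains -/

/-- `Γ ⊆ ℝⁿ` is nonempty and `d`-Ahlfors regular: `r ^ d / A ≤ σ (B(ξ, r) ∩ Γ) ≤ A r ^ d` for all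
`ξ ∈ Γ` and all real `0 < r ≤ diam Γ`, where `σ` is the `d`-dimensional Hausdorff measure.
(The diameter is taken in `[0, ∞]`, since `Γ` may be unbounded.) -/
def IsAhlforsRegular {n : ℕ} (d : ℝ) (Γ : Set (E n)) : Prop :=
  Γ.Nonempty ∧ ∃ A : ℝ, 0 < A ∧ ∀ ξ ∈ Γ, ∀ r : ℝ, 0 < r → ENNReal.ofReal r ≤ Metric.ediam Γ →
    ENNReal.ofReal (A⁻¹ * r ^ d) ≤ μH[d] (Metric.ball ξ r ∩ Γ) ∧
      μH[d] (Metric.ball ξ r ∩ Γ) ≤ ENNReal.ofReal (A * r ^ d)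

/-- The distance `δ(y) = dist(y, ∂Ω)`. -/
def bdist {n : ℕ} (Ω : Set (E n)) (y : E n) : ℝ := Metric.infDist y (frontier Ω)

/-- There is a `lam`-carrot path in `Ω` from the boundary point `x` to `y`: a continuous rectifiable
path `ζ : [0, T] → Ω ∪ {x}` parameterized by arc length, with `ζ(0) = x`, `ζ(T) = y` and
`δ(ζ(t)) ≥ lam * t`. -/
def HasCarrotPath {n : ℕ} (Ω : Set (E n)) (lam : ℝ) (x y : E n) : Prop :=
  ∃ (T : ℝ) (ζ : ℝ → E n), 0 ≤ T ∧ ContinuousOn ζ (Icc 0 T) ∧ HasUnitSpeedOn ζ (Icc 0 T) ∧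
    MapsTo ζ (Icc 0 T) (Ω ∪ {x}) ∧ ζ 0 = x ∧ ζ T = y ∧
    ∀ t ∈ Icc 0 T, lam * t ≤ bdist Ω (ζ t)

/-- `y` is a `(θ, lam, N)`-weak local John point of `Ω` (with respect to the `d`-dimensional
Hausdorff measure on `∂Ω`). -/
def IsWeakLocalJohnPoint {n : ℕ} (Ω : Set (E n)) (d θ lam N : ℝ) (y : E n) : Prop :=
  ∃ F : Set (E n), MeasurableSet F ∧ F ⊆ Metric.ball y (N * bdist Ω y) ∩ frontier Ω ∧
    ENNReal.ofReal θ * μH[d] (Metric.ball y (N * bdist Ω y) ∩ frontier Ω) ≤ μH[d] F ∧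
    ∀ x ∈ F, HasCarrotPath Ω lam x y

/-- `Ω ⊆ ℝⁿ` is a weak local John domain with `d`-Ahlfors regular boundary, `0 < d < n`. -/
def IsWeakLocalJohnDomain {n : ℕ} (Ω : Set (E n)) (d : ℝ) : Prop :=
  IsOpen Ω ∧ 0 < d ∧ d < n ∧ IsAhlforsRegular d (frontier Ω) ∧
    ∃ θ lam N : ℝ, 0 < θ ∧ θ ≤ 1 ∧ 0 < lam ∧ lam ≤ 1 ∧ 2 ≤ N ∧
      ∀ y ∈ Ω, IsWeakLocalJohnPoint Ω d θ lam N y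

/-! ### Function spaces

Functions on `Ω` are represented by functions on `ℝⁿ` of which only the values on `Ω` matter. -/

/-- `φ ∈ C₀^∞(Ω)`: a smooth function with compact support contained in `Ω`. -/
structure IsTestFunction {n : ℕ} (Ω : Set (E n)) (φ : E n → ℝ) : Prop where
  smooth : ContDiff ℝ ∞ φ
  compact : HasCompactSupport φ
  subset : tsupport φ ⊆ Ω

/-- `f ∈ L^β_loc(Ω)`. -/
def MemLpLoc {n : ℕ} {F : Type*} [NormedAddCommGroup F] (Ω : Set (E n)) (β : ℝ) (f : E n → F) :
    Prop :=
  ∀ K : Set (E n), IsCompact K → K ⊆ Ω → MemLp f (ENNReal.ofReal β) (volume.restrict K)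

/-- The locally integrable vector field `G` is the weak gradient in `Ω` of the locally integrable
function `u`. It is determined almost everywhere in `Ω`. -/
structure HasWeakGradient {n : ℕ} (Ω : Set (E n)) (u : E n → ℝ) (G : E n → E n) : Prop where
  integrable : LocallyIntegrableOn u Ω
  integrable_grad : LocallyIntegrableOn G Ω
  integral_eq : ∀ φ : E n → ℝ, IsTestFunction Ω φ → ∀ v : E n,
    ∫ x in Ω, u x * fderiv ℝ φ x v = - ∫ x in Ω, inner ℝ (G x) v * φ x

/-- `u` is in the local homogeneous Sobolev space `Ẇ^{1,β}_loc(Ω)`. -/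
def MemSobolevLoc {n : ℕ} (Ω : Set (E n)) (β : ℝ) (u : E n → ℝ) : Prop :=
  ∃ G : E n → E n, HasWeakGradient Ω u G ∧ MemLpLoc Ω β G

/-- The Whitney averaging operator
`W_{c,β} f (y) = (⨍_{B(y, c δ(y))} |f|^β)^{1/β}`, for finite `β`, with values in `[0, ∞]`. -/
def whitneyAvg {n : ℕ} {F : Type*} [NormedAddCommGroup F] (Ω : Set (E n)) (c β : ℝ) (f : E n → F)
    (y : E n) : ℝ≥0∞ :=
  (⨍⁻ z in Metric.ball y (c * bdist Ω y), ‖f z‖ₑ ^ β ∂volume) ^ (1 / β)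

/-- The norm of the weighted averaged Lebesgue space `L^p_{av,c,β,s}(Ω)`, for finite `p`, `β`,
`(∫_Ω (W_{c,β} f)^p δ^{d - n + p - p s})^{1/p}`, with values in `[0, ∞]`. -/
def lebesgueNorm {n : ℕ} {F : Type*} [NormedAddCommGroup F] (Ω : Set (E n)) (d p c β s : ℝ)
    (f : E n → F) : ℝ≥0∞ :=
  (∫⁻ y in Ω, whitneyAvg Ω c β f y ^ p *
    ENNReal.ofReal (bdist Ω y ^ (d - n + p - p * s))) ^ (1 / p)

/-- `f ∈ L^p_{av,c,β,s}(Ω)`. -/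
def MemLebesgue {n : ℕ} {F : Type*} [NormedAddCommGroup F] (Ω : Set (E n)) (d p c β s : ℝ)
    (f : E n → F) : Prop :=
  MemLpLoc Ω β f ∧ lebesgueNorm Ω d p c β s f < ⊤

/-- The norm `‖∇u‖_{L^p_{av,c,β,s}(Ω)}` of `Ẇ^{1,p}_{av,c,β,s}(Ω)`. The infimum runs over the
versions of the weak gradient, which agree almost everywhere in `Ω` and so all give the same value;
it is `∞` if `u` has no weak gradient. -/
def sobolevNorm {n : ℕ} (Ω : Set (E n)) (d p c β s : ℝ) (u : E n → ℝ) : ℝ≥0∞ :=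
  ⨅ (G : E n → E n) (_ : HasWeakGradient Ω u G), lebesgueNorm Ω d p c β s G

/-- `u ∈ Ẇ^{1,p}_{av,c,β,s}(Ω)`. -/
def MemSobolev {n : ℕ} (Ω : Set (E n)) (d p c β s : ℝ) (u : E n → ℝ) : Prop :=
  MemSobolevLoc Ω β u ∧ sobolevNorm Ω d p c β s u < ⊤

/-- `u` is in the trace zero space
`W̃^{1,p}_{av,c,β,s}(Ω) = Ẇ^{1,p}_{av,c,β,s}(Ω) ∩ L^p_{av,c,β,s+1}(Ω)`. -/
def MemTraceless {n : ℕ} (Ω : Set (E n)) (d p c β s : ℝ) (u : E n → ℝ) : Prop :=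
  MemSobolev Ω d p c β s u ∧ MemLebesgue Ω d p c β (s + 1) u

/-- The norm of the Banach space `W̃^{1,p}_{av,c,β,s}(Ω)`. -/
def tracelessNorm {n : ℕ} (Ω : Set (E n)) (d p c β s : ℝ) (u : E n → ℝ) : ℝ≥0∞ :=
  sobolevNorm Ω d p c β s u + lebesgueNorm Ω d p c β (s + 1) u

end AveragedSobolev

end

open AveragedSobolev

namespace AveragedSobolev

open Filter Topology Metric

/-! ### The distance to the boundary -/

/-! The membership `u ∈ L^p_{av,c,β,s+1}` says exactly that `u / δ` has finite norm at smoothness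
`s`, since on a Whitney ball `δ` is comparable to its value at the centre
(`lebesgueNormENN_div_bdist_le`). This is what makes cutting off harmless. There are test functions
`η`, equal to `1` on arbitrarily large parts of `Ω`, with `|∇η| ≤ C / δ` for a `C` independent of
the cutoff (`exists_cutoff`). The gradient error `(1 - η)∇u - u∇η` is then dominated by `|∇u| +
C|u|/δ`, which has finite norm, and vanishes where `η` is locally `1`. Along an exhaustion of `Ω`,
dominated convergence sends this error and `(1 - η)u` to zero
(`tendsto_lebesgueNormENN_of_exhaustion`, `exists_cutoff_near`).

It remains to approximate the compactly supported function `ηu`. On functions supported in a fixed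
compact subset of `Ω` the averaged norms are bounded by the `L^β` norm
(`exists_lebesgueNorm_le_eLpNorm`), so mollification in `L^β` of `ηu` and of its weak gradient
suffices (`exists_eLpNorm_convolution_sub_le`, `gradient_convolution_normed`). The same bound puts
test functions in the space. -/

theorem bdist_pos {n : ℕ} {Ω : Set (E n)} (hΩ : IsOpen Ω) (hfr : (frontier Ω).Nonempty) {y : E n}
    (hy : y ∈ Ω) : 0 < bdist Ω y := by
  refine (isClosed_frontier.notMem_iff_infDist_pos hfr).1 fun h => ?_
  rw [hΩ.frontier_eq] at h
  exact h.2 hy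

theorem continuous_bdist {n : ℕ} (Ω : Set (E n)) : Continuous (bdist Ω) :=
  continuous_infDist_pt _

theorem bdist_le_add_dist {n : ℕ} (Ω : Set (E n)) (x y : E n) :
    bdist Ω x ≤ bdist Ω y + dist x y :=
  infDist_le_infDist_add_dist

/-- The ball is connected, meets `Ω`, and contains no boundary point, so it cannot leave `Ω`. -/
theorem ball_bdist_subset {n : ℕ} {Ω : Set (E n)} (hΩ : IsOpen Ω) (hfr : (frontier Ω).Nonempty)
    {y : E n} (hy : y ∈ Ω) : ball y (bdist Ω y) ⊆ Ω := by
  have hy0 := bdist_pos hΩ hfr hy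
  refine (convex_ball y (bdist Ω y)).isPreconnected.subset_of_closure_inter_subset hΩ
    ⟨y, mem_ball_self hy0, hy⟩ ?_
  rintro z ⟨hz, hzb⟩
  by_contra hzΩ
  exact ball_infDist_subset_compl hzb (by rw [hΩ.frontier_eq]; exact ⟨hz, hzΩ⟩)

theorem whitneyBall_subset {n : ℕ} {Ω : Set (E n)} (hΩ : IsOpen Ω) (hfr : (frontier Ω).Nonempty)
    {c : ℝ} (hc1 : c < 1) {y : E n} (hy : y ∈ Ω) : ball y (c * bdist Ω y) ⊆ Ω :=
  (ball_subset_ball (by nlinarith [bdist_pos hΩ hfr hy])).trans (ball_bdist_subset hΩ hfr hy)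

theorem isCompact_setOf_le_bdist {n : ℕ} {Ω : Set (E n)} (hΩ : IsOpen Ω) {ε : ℝ} (hε : 0 < ε)
    (R : ℝ) : IsCompact {x : E n | x ∈ Ω ∧ ε ≤ bdist Ω x ∧ ‖x‖ ≤ R} := by
  -- Replacing `Ω` by its closure adds only boundary points, where `δ = 0 < ε`; the set is thus
  -- closed.
  have h : {x : E n | x ∈ Ω ∧ ε ≤ bdist Ω x ∧ ‖x‖ ≤ R} =
      closedBall 0 R ∩ (closure Ω ∩ {x | ε ≤ bdist Ω x}) := by
    ext x
    simp only [mem_ofPred_eq, mem_inter_iff, mem_closedBall_zero_iff]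
    refine ⟨fun h => ⟨h.2.2, subset_closure h.1, h.2.1⟩, fun h => ⟨?_, h.2.2, h.1⟩⟩
    by_contra hx
    have : x ∈ frontier Ω := by rw [hΩ.frontier_eq]; exact ⟨h.2.1, hx⟩
    have h0 : bdist Ω x = 0 := infDist_zero_of_mem this
    linarith [h.2.2]
  rw [h]
  exact (isCompact_closedBall 0 R).inter_right
    (isClosed_closure.inter (isClosed_le continuous_const (continuous_bdist Ω)))

/-! ### Averaged norms of extended nonnegative functions -/

/-- The Whitney average of a function with values in `[0, ∞]`. -/
noncomputable def whitneyAvgENN {n : ℕ} (Ω : Set (E n)) (c β : ℝ) (g : E n → ℝ≥0∞) (y : E n) : ℝ≥0∞ :=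
  (⨍⁻ z in ball y (c * bdist Ω y), g z ^ β ∂volume) ^ (1 / β)

/-- The weighted averaged Lebesgue norm of a function with values in `[0, ∞]`. -/
noncomputable def lebesgueNormENN {n : ℕ} (Ω : Set (E n)) (d p c β s : ℝ) (g : E n → ℝ≥0∞) : ℝ≥0∞ :=
  (∫⁻ y in Ω, whitneyAvgENN Ω c β g y ^ p *
    ENNReal.ofReal (bdist Ω y ^ (d - n + p - p * s))) ^ (1 / p)

/-- Working with `[0, ∞]`-valued integrands lets the majorant `|∇u| + C|u|/δ` be treated on the same
footing as scalar and vector-valued functions. -/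
theorem lebesgueNorm_eq {n : ℕ} {F : Type*} [NormedAddCommGroup F] (Ω : Set (E n))
    (d p c β s : ℝ) (f : E n → F) :
    lebesgueNorm Ω d p c β s f = lebesgueNormENN Ω d p c β s (fun z => ‖f z‖ₑ) := rfl

section Basic

variable {n : ℕ} {Ω : Set (E n)} {c β : ℝ}

theorem whitneyAvgENN_mono_ae (hΩ : IsOpen Ω) (hfr : (frontier Ω).Nonempty) (hc1 : c < 1)
    (hβ : 1 ≤ β) {g h : E n → ℝ≥0∞} (hgh : ∀ᵐ z ∂volume.restrict Ω, g z ≤ h z) {y : E n}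
    (hy : y ∈ Ω) : whitneyAvgENN Ω c β g y ≤ whitneyAvgENN Ω c β h y := by
  unfold whitneyAvgENN
  have hβ0 : 0 < β := by linarith
  refine ENNReal.rpow_le_rpow ?_ (by positivity)
  rw [setLAverage_eq, setLAverage_eq]
  refine ENNReal.div_le_div_right (lintegral_mono_ae ?_) _
  filter_upwards [ae_restrict_of_ae_restrict_of_subset
    (whitneyBall_subset hΩ hfr hc1 hy) hgh] with z hz
  exact ENNReal.rpow_le_rpow hz hβ0.le

theorem whitneyAvgENN_congr_ae (hΩ : IsOpen Ω) (hfr : (frontier Ω).Nonempty) (hc1 : c < 1)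
    (hβ : 1 ≤ β) {g h : E n → ℝ≥0∞} (hgh : ∀ᵐ z ∂volume.restrict Ω, g z = h z) {y : E n}
    (hy : y ∈ Ω) : whitneyAvgENN Ω c β g y = whitneyAvgENN Ω c β h y :=
  le_antisymm (whitneyAvgENN_mono_ae hΩ hfr hc1 hβ (hgh.mono fun _ h => h.le) hy)
    (whitneyAvgENN_mono_ae hΩ hfr hc1 hβ (hgh.mono fun _ h => h.ge) hy)

/-- The moving balls are the sections of an open set in the product, so Tonelli's theorem gives
measurability in the centre. -/
theorem measurable_setLIntegral_ball {g : E n → ℝ≥0∞} (hg : Measurable g) :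
    Measurable fun y => ∫⁻ z in ball y (c * bdist Ω y), g z := by
  have hS : MeasurableSet {q : E n × E n | dist q.2 q.1 < c * bdist Ω q.1} :=
    (isOpen_lt (by fun_prop) (continuous_const.mul
      ((continuous_bdist Ω).comp continuous_fst))).measurableSet
  have h := Measurable.lintegral_prod_right' (ν := (volume : Measure (E n)))
    ((hg.comp measurable_snd).indicator hS)
  convert h using 2 with y
  rw [← lintegral_indicator measurableSet_ball]
  rfl

theorem measurable_whitneyAvgENN {g : E n → ℝ≥0∞} (hg : Measurable g) :
    Measurable (whitneyAvgENN Ω c β g) := by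
  unfold whitneyAvgENN
  simp only [setLAverage_eq]
  refine Measurable.pow_const (Measurable.div (measurable_setLIntegral_ball
    (hg.pow_const β)) ?_) _
  have h := measurable_setLIntegral_ball (Ω := Ω) (c := c) (g := fun _ => 1) measurable_const
  simpa using h

theorem aemeasurable_whitneyAvgENN (hΩ : IsOpen Ω) (hfr : (frontier Ω).Nonempty) (hc1 : c < 1)
    (hβ : 1 ≤ β) {g : E n → ℝ≥0∞} (hg : AEMeasurable g (volume.restrict Ω)) :
    AEMeasurable (whitneyAvgENN Ω c β g) (volume.restrict Ω) :=
  ⟨_, measurable_whitneyAvgENN hg.measurable_mk, by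
    filter_upwards [ae_restrict_mem hΩ.measurableSet] with y hy
    exact whitneyAvgENN_congr_ae hΩ hfr hc1 hβ hg.ae_eq_mk hy⟩

theorem whitneyAvgENN_add_le (hΩ : IsOpen Ω) (hfr : (frontier Ω).Nonempty) (hc1 : c < 1)
    (hβ : 1 ≤ β) {g h : E n → ℝ≥0∞} (hg : AEMeasurable g (volume.restrict Ω))
    (hh : AEMeasurable h (volume.restrict Ω)) {y : E n} (hy : y ∈ Ω) :
    whitneyAvgENN Ω c β (fun z => g z + h z) y ≤
      whitneyAvgENN Ω c β g y + whitneyAvgENN Ω c β h y := by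
  unfold whitneyAvgENN
  simp only [laverage_eq']
  have hsub := whitneyBall_subset hΩ hfr hc1 hy
  exact ENNReal.lintegral_Lp_add_le
    ((hg.mono_measure (Measure.restrict_mono hsub le_rfl)).smul_measure _)
    ((hh.mono_measure (Measure.restrict_mono hsub le_rfl)).smul_measure _) hβ

theorem whitneyAvgENN_le_const_mul (hβ : 1 ≤ β) {g h : E n → ℝ≥0∞} {y : E n}
    {a : ℝ≥0∞} (ha : a ≠ ⊤) (hgh : ∀ z ∈ ball y (c * bdist Ω y), g z ≤ a * h z) :
    whitneyAvgENN Ω c β g y ≤ a * whitneyAvgENN Ω c β h y := by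
  have hβ0 : 0 < β := by linarith
  have h1 : a = (a ^ β) ^ (1 / β) := by
    rw [← ENNReal.rpow_mul, mul_one_div_cancel hβ0.ne', ENNReal.rpow_one]
  unfold whitneyAvgENN
  conv_rhs => rw [h1]
  rw [← ENNReal.mul_rpow_of_nonneg _ _ (by positivity)]
  refine ENNReal.rpow_le_rpow ?_ (by positivity)
  rw [setLAverage_eq, setLAverage_eq, ← mul_div_assoc,
    ← lintegral_const_mul' _ _ (ENNReal.rpow_ne_top_of_nonneg hβ0.le ha)]
  refine ENNReal.div_le_div_right (setLIntegral_mono' measurableSet_ball fun z hz => ?_) _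
  rw [← ENNReal.mul_rpow_of_nonneg _ _ hβ0.le]
  exact ENNReal.rpow_le_rpow (hgh z hz) hβ0.le

theorem whitneyAvgENN_eq_zero (hβ : 1 ≤ β) {g : E n → ℝ≥0∞} {y : E n}
    (hg : ∀ z ∈ ball y (c * bdist Ω y), g z = 0) : whitneyAvgENN Ω c β g y = 0 := by
  have hβ0 : 0 < β := by linarith
  unfold whitneyAvgENN
  rw [setLAverage_eq, setLIntegral_congr_fun (g := fun _ => 0) measurableSet_ball
    (fun z hz => by simp [hg z hz, hβ0])]
  simp [hβ0]

variable {d p s : ℝ}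

theorem lebesgueNormENN_mono_ae (hΩ : IsOpen Ω) (hfr : (frontier Ω).Nonempty) (hp : 1 ≤ p)
    (hc1 : c < 1) (hβ : 1 ≤ β) {g h : E n → ℝ≥0∞} (hgh : ∀ᵐ z ∂volume.restrict Ω, g z ≤ h z) :
    lebesgueNormENN Ω d p c β s g ≤ lebesgueNormENN Ω d p c β s h := by
  have hp0 : 0 < p := by linarith
  refine ENNReal.rpow_le_rpow (setLIntegral_mono' hΩ.measurableSet fun y hy => ?_) (by positivity)
  gcongr
  exact whitneyAvgENN_mono_ae hΩ hfr hc1 hβ hgh hy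

theorem measurable_weight (e : ℝ) :
    Measurable fun y : E n => ENNReal.ofReal (bdist Ω y ^ e) :=
  ((continuous_bdist Ω).measurable.pow_const e).ennreal_ofReal

theorem lebesgueNormENN_add_le (hΩ : IsOpen Ω) (hfr : (frontier Ω).Nonempty) (hp : 1 ≤ p)
    (hc1 : c < 1) (hβ : 1 ≤ β) {g h : E n → ℝ≥0∞} (hg : AEMeasurable g (volume.restrict Ω))
    (hh : AEMeasurable h (volume.restrict Ω)) :
    lebesgueNormENN Ω d p c β s (fun z => g z + h z) ≤
      lebesgueNormENN Ω d p c β s g + lebesgueNormENN Ω d p c β s h := by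
  have hp0 : 0 < p := by linarith
  set w : E n → ℝ≥0∞ := fun y => ENNReal.ofReal (bdist Ω y ^ (d - n + p - p * s)) with hw
  have hwm : Measurable w := measurable_weight _
  -- Absorbing the weight as a factor `w ^ (1 / p)` makes this an unweighted `L^p` norm, to which
  -- Minkowski's inequality applies; the inner average has its own Minkowski inequality.
  have key : ∀ k : E n → ℝ≥0∞, lebesgueNormENN Ω d p c β s k =
      (∫⁻ y in Ω, (whitneyAvgENN Ω c β k y * w y ^ (1 / p)) ^ p) ^ (1 / p) := by
    intro k
    unfold lebesgueNormENN
    congr 2 with y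
    rw [ENNReal.mul_rpow_of_nonneg _ _ hp0.le, ← ENNReal.rpow_mul, one_div_mul_cancel hp0.ne',
      ENNReal.rpow_one]
  rw [key, key, key]
  refine le_trans ?_ (ENNReal.lintegral_Lp_add_le
    ((aemeasurable_whitneyAvgENN hΩ hfr hc1 hβ hg).mul (hwm.pow_const _).aemeasurable)
    ((aemeasurable_whitneyAvgENN hΩ hfr hc1 hβ hh).mul (hwm.pow_const _).aemeasurable) hp)
  refine ENNReal.rpow_le_rpow (setLIntegral_mono' hΩ.measurableSet fun y hy => ?_) (by positivity)
  refine ENNReal.rpow_le_rpow ?_ hp0.le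
  simp only [Pi.add_apply, ← add_mul]
  gcongr
  exact whitneyAvgENN_add_le hΩ hfr hc1 hβ hg hh hy

theorem lebesgueNormENN_const_mul_le (hp : 1 ≤ p) (hβ : 1 ≤ β) {g : E n → ℝ≥0∞}
    {a : ℝ≥0∞} (ha : a ≠ ⊤) :
    lebesgueNormENN Ω d p c β s (fun z => a * g z) ≤ a * lebesgueNormENN Ω d p c β s g := by
  have hp0 : 0 < p := by linarith
  have h1 : a = (a ^ p) ^ (1 / p) := by
    rw [← ENNReal.rpow_mul, mul_one_div_cancel hp0.ne', ENNReal.rpow_one]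
  unfold lebesgueNormENN
  conv_rhs => rw [h1]
  rw [← ENNReal.mul_rpow_of_nonneg _ _ (by positivity),
    ← lintegral_const_mul' _ _ (ENNReal.rpow_ne_top_of_nonneg hp0.le ha)]
  refine ENNReal.rpow_le_rpow (lintegral_mono fun y => ?_) (by positivity)
  rw [← mul_assoc, ← ENNReal.mul_rpow_of_nonneg _ _ hp0.le]
  gcongr
  exact whitneyAvgENN_le_const_mul hβ ha fun z _ => le_rfl

/-- For `z` in the Whitney ball of `y` one has `δ(z) ≥ (1 - c) δ(y)`, so `1/δ` leaves the average at
the cost of `(1 - c)⁻¹`. Its `p`-th power `δ(y)^(-p)` shifts the weight from `s` to `s + 1`. -/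
theorem lebesgueNormENN_div_bdist_le (hΩ : IsOpen Ω) (hfr : (frontier Ω).Nonempty) (hp : 1 ≤ p)
    (hc : 0 < c) (hc1 : c < 1) (hβ : 1 ≤ β) (g : E n → ℝ≥0∞) :
    lebesgueNormENN Ω d p c β s (fun z => ENNReal.ofReal (bdist Ω z)⁻¹ * g z) ≤
      ENNReal.ofReal (1 - c)⁻¹ * lebesgueNormENN Ω d p c β (s + 1) g := by
  have hp0 : 0 < p := by linarith
  set a : ℝ≥0∞ := ENNReal.ofReal (1 - c)⁻¹ with ha
  have h1 : a = (a ^ p) ^ (1 / p) := by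
    rw [← ENNReal.rpow_mul, mul_one_div_cancel hp0.ne', ENNReal.rpow_one]
  unfold lebesgueNormENN
  conv_rhs => rw [h1]
  rw [← ENNReal.mul_rpow_of_nonneg _ _ (by positivity),
    ← lintegral_const_mul' _ _ (ENNReal.rpow_ne_top_of_nonneg hp0.le ENNReal.ofReal_ne_top)]
  refine ENNReal.rpow_le_rpow (setLIntegral_mono' hΩ.measurableSet fun y hy => ?_) (by positivity)
  have hy0 := bdist_pos hΩ hfr hy
  have h2 : whitneyAvgENN Ω c β (fun z => ENNReal.ofReal (bdist Ω z)⁻¹ * g z) y ≤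
      ENNReal.ofReal ((1 - c)⁻¹ * (bdist Ω y)⁻¹) * whitneyAvgENN Ω c β g y := by
    refine whitneyAvgENN_le_const_mul hβ ENNReal.ofReal_ne_top fun z hz => ?_
    gcongr
    rw [← mul_inv]
    have := bdist_le_add_dist Ω y z
    rw [mem_ball'] at hz
    refine inv_anti₀ (mul_pos (by linarith) hy0) (by linarith)
  have hc' : 0 < (1 - c)⁻¹ := inv_pos.2 (by linarith)
  calc _ ≤ (ENNReal.ofReal ((1 - c)⁻¹ * (bdist Ω y)⁻¹) * whitneyAvgENN Ω c β g y) ^ p *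
        ENNReal.ofReal (bdist Ω y ^ (d - n + p - p * s)) := by gcongr
    _ = a ^ p * (whitneyAvgENN Ω c β g y ^ p * (ENNReal.ofReal (bdist Ω y)⁻¹ ^ p *
        ENNReal.ofReal (bdist Ω y ^ (d - n + p - p * s)))) := by
      rw [ENNReal.mul_rpow_of_nonneg _ _ hp0.le, ENNReal.ofReal_mul hc'.le,
        ENNReal.mul_rpow_of_nonneg _ _ hp0.le]
      ring
    _ = _ := by
      congr 2
      rw [ENNReal.ofReal_rpow_of_pos (inv_pos.2 hy0), ← ENNReal.ofReal_mul (by positivity),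
        Real.inv_rpow hy0.le, ← Real.rpow_neg hy0.le, ← Real.rpow_add hy0]
      congr 2
      ring

/-- Dominated convergence, with the integrand of `g` as majorant: for each `y` the integrand
vanishes as soon as `K k` contains the Whitney ball of `y`. -/
theorem tendsto_lebesgueNormENN_of_exhaustion (hΩ : IsOpen Ω) (hfr : (frontier Ω).Nonempty)
    (hp : 1 ≤ p) (hc1 : c < 1) (hβ : 1 ≤ β) {g : E n → ℝ≥0∞} {K : ℕ → Set (E n)}
    (hKm : ∀ k, MeasurableSet (K k))
    (hK : ∀ y ∈ Ω, ∀ᶠ k in atTop, ball y (c * bdist Ω y) ⊆ K k)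
    (hg : AEMeasurable g (volume.restrict Ω)) (hfin : lebesgueNormENN Ω d p c β s g ≠ ⊤) :
    Tendsto (fun k => lebesgueNormENN Ω d p c β s ((K k)ᶜ.indicator g)) atTop (𝓝 0) := by
  have hp0 : 0 < p := by linarith
  have hp1 : 0 < 1 / p := by positivity
  have h : Tendsto (fun k => ∫⁻ y in Ω, whitneyAvgENN Ω c β ((K k)ᶜ.indicator g) y ^ p *
      ENNReal.ofReal (bdist Ω y ^ (d - n + p - p * s))) atTop (𝓝 (∫⁻ y in Ω, 0)) := by
    refine tendsto_lintegral_of_dominated_convergence'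
      (fun y => whitneyAvgENN Ω c β g y ^ p *
        ENNReal.ofReal (bdist Ω y ^ (d - n + p - p * s))) (fun k => ?_) (fun k => ?_) ?_ ?_
    · exact ((aemeasurable_whitneyAvgENN hΩ hfr hc1 hβ
        (hg.indicator (hKm k).compl)).pow_const p).mul (measurable_weight _).aemeasurable
    · filter_upwards [ae_restrict_mem hΩ.measurableSet] with y hy
      gcongr
      exact whitneyAvgENN_mono_ae hΩ hfr hc1 hβ
        (Eventually.of_forall fun z => indicator_le_self _ _ z) hy
    · intro h
      apply hfin
      unfold lebesgueNormENN
      rw [h, ENNReal.top_rpow_of_pos hp1]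
    · filter_upwards [ae_restrict_mem hΩ.measurableSet] with y hy
      refine tendsto_const_nhds.congr' ?_
      filter_upwards [hK y hy] with k hk
      rw [whitneyAvgENN_eq_zero hβ (fun z hz => indicator_of_notMem (by simpa using hk hz) _)]
      simp [hp0]
  have h' := h.ennrpow_const (1 / p)
  simpa [hp0, lebesgueNormENN] using h'

/-- On functions supported in a fixed compact subset of `Ω`, the weighted averaged Lebesgue norm
is controlled by the `L^β` norm. -/
theorem exists_lebesgueNorm_le_eLpNorm {F : Type*} [NormedAddCommGroup F] (hΩ : IsOpen Ω)
    (hfr : (frontier Ω).Nonempty) (hp : 1 ≤ p) (hc : 0 < c) (hc1 : c < 1) (hβ : 1 ≤ β)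
    {K : Set (E n)} (hK : IsCompact K) (hKΩ : K ⊆ Ω) :
    ∃ C : ℝ≥0∞, C ≠ ⊤ ∧ ∀ f : E n → F, Function.support f ⊆ K →
      lebesgueNorm Ω d p c β s f ≤ C * eLpNorm f (ENNReal.ofReal β) volume := by
  have hp0 : 0 < p := by linarith
  have hβ0 : 0 < β := by linarith
  rcases K.eq_empty_or_nonempty with rfl | hKne
  · refine ⟨0, by simp, fun f hf => ?_⟩
    have hf0 : f = 0 := Function.support_eq_empty_iff.1 (subset_empty_iff.1 hf)
    have : lebesgueNormENN Ω d p c β s (fun z => ‖f z‖ₑ) = 0 := by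
      unfold lebesgueNormENN
      rw [lintegral_congr (g := fun _ => 0)]
      · simp [hp0]
      · intro y
        rw [whitneyAvgENN_eq_zero hβ (by simp [hf0])]
        simp [hp0]
    rw [lebesgueNorm_eq, this]
    exact zero_le
  obtain ⟨z₁, hz₁, hmin⟩ := hK.exists_isMinOn hKne (continuous_bdist Ω).continuousOn
  obtain ⟨z₂, hz₂, hmax⟩ := hK.exists_isMaxOn hKne (continuous_bdist Ω).continuousOn
  obtain ⟨R, hR⟩ := hK.isBounded.exists_norm_le
  have hm := bdist_pos hΩ hfr (hKΩ hz₁)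
  set m := bdist Ω z₁ with hmdef
  set M := bdist Ω z₂ with hMdef
  set a := m / 2 with hadef
  set b := M / (1 - c) with hbdef
  -- `S` contains the centre `y` of every Whitney ball that meets `K` in a point `z`: `δ(z) ≤ 2
  -- δ(y)` gives `a`, `(1 - c) δ(y) ≤ δ(z)` gives `b`, and `‖y‖ ≤ ‖z‖ + c δ(y)` gives `R + b`. On
  -- `S` the balls have volume at least `v` below and the weight is bounded, whatever the sign of
  -- its exponent.
  set S : Set (E n) := {y | a ≤ bdist Ω y ∧ bdist Ω y ≤ b ∧ ‖y‖ ≤ R + b} with hS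
  have hSc : IsCompact S := by
    have : S = closedBall 0 (R + b) ∩ ({y | a ≤ bdist Ω y} ∩ {y | bdist Ω y ≤ b}) := by
      ext y
      simp only [hS, mem_ofPred_eq, mem_inter_iff, mem_closedBall_zero_iff]
      tauto
    rw [this]
    exact (isCompact_closedBall 0 _).inter_right
      ((isClosed_le continuous_const (continuous_bdist Ω)).inter
        (isClosed_le (continuous_bdist Ω) continuous_const))
  have ha0 : 0 < a := by positivity
  set e := d - n + p - p * s with he
  obtain ⟨B, hB⟩ : ∃ B : ℝ, ∀ y ∈ S, bdist Ω y ^ e ≤ B := by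
    obtain ⟨B, hB⟩ := hSc.exists_bound_of_continuousOn (f := fun y => bdist Ω y ^ e)
      ((continuous_bdist Ω).continuousOn.rpow_const
        fun y hy => Or.inl (by have := hy.1; linarith))
    exact ⟨B, fun y hy => (le_abs_self _).trans (hB y hy)⟩
  set v : ℝ≥0∞ := volume (ball (0 : E n) (c * a)) with hv
  have hv0 : v ≠ 0 := (measure_ball_pos _ _ (by positivity)).ne'
  have hW : ∀ f : E n → F, Function.support f ⊆ K → ∀ y ∈ Ω,
      whitneyAvgENN Ω c β (fun z => ‖f z‖ₑ) y ≤
        S.indicator (fun _ => (v⁻¹) ^ (1 / β) * eLpNorm f (ENNReal.ofReal β) volume) y := by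
    intro f hf y hy
    have hy0 := bdist_pos hΩ hfr hy
    by_cases hyS : y ∈ S
    · rw [indicator_of_mem hyS, eLpNorm_eq_lintegral_rpow_enorm_toReal (by simp [hβ0]) (by simp),
        ENNReal.toReal_ofReal hβ0.le, ← ENNReal.mul_rpow_of_nonneg _ _ (by positivity)]
      unfold whitneyAvgENN
      refine ENNReal.rpow_le_rpow ?_ (by positivity)
      rw [setLAverage_eq, ENNReal.div_eq_inv_mul]
      gcongr
      · rw [hv, ← Measure.addHaar_ball_center volume y]
        exact measure_mono (ball_subset_ball (by gcongr; exact hyS.1))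
      · exact Measure.restrict_le_self
    · rw [indicator_of_notMem hyS]
      refine (whitneyAvgENN_eq_zero hβ fun z hz => ?_).le
      by_contra hfz
      have hzK : z ∈ K := hf (by simpa using hfz)
      apply hyS
      have h1 : m ≤ bdist Ω z := hmin hzK
      have h2 : bdist Ω z ≤ M := hmax hzK
      have h3 := bdist_le_add_dist Ω y z
      have h4 := bdist_le_add_dist Ω z y
      have h5 : bdist Ω y ≤ b := by
        rw [hbdef, le_div_iff₀ (by linarith)]
        rw [mem_ball'] at hz
        nlinarith
      refine ⟨?_, h5, ?_⟩
      · rw [mem_ball] at hz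
        have : c * bdist Ω y ≤ bdist Ω y := by nlinarith
        rw [hadef]; linarith
      · have h6 : ‖y‖ ≤ ‖z‖ + dist y z := by
          rw [dist_eq_norm]
          simpa using norm_add_le z (y - z)
        rw [mem_ball'] at hz
        have := hR z hzK
        have : c * bdist Ω y ≤ bdist Ω y := by nlinarith
        linarith
  refine ⟨(((v⁻¹) ^ (1 / β)) ^ p * (ENNReal.ofReal B * volume S)) ^ (1 / p), ?_, fun f hf => ?_⟩
  · refine ENNReal.rpow_ne_top_of_nonneg (by positivity) (ENNReal.mul_ne_top ?_
      (ENNReal.mul_ne_top ENNReal.ofReal_ne_top hSc.measure_lt_top.ne))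
    exact ENNReal.rpow_ne_top_of_nonneg hp0.le
      (ENNReal.rpow_ne_top_of_nonneg (by positivity) (ENNReal.inv_ne_top.2 hv0))
  · set N := eLpNorm f (ENNReal.ofReal β) volume with hN
    have h1 : N = (N ^ p) ^ (1 / p) := by
      rw [← ENNReal.rpow_mul, mul_one_div_cancel hp0.ne', ENNReal.rpow_one]
    rw [lebesgueNorm_eq]
    conv_rhs => rw [h1]
    rw [← ENNReal.mul_rpow_of_nonneg _ _ (by positivity)]
    refine ENNReal.rpow_le_rpow ?_ (by positivity)
    calc _ ≤ ∫⁻ y in Ω, S.indicator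
          (fun _ => ((v⁻¹) ^ (1 / β) * N) ^ p * ENNReal.ofReal B) y := by
          refine setLIntegral_mono' hΩ.measurableSet fun y hy => ?_
          refine (mul_le_mul_left (ENNReal.rpow_le_rpow (hW f hf y hy) hp0.le) _).trans ?_
          by_cases hyS : y ∈ S
          · rw [indicator_of_mem hyS, indicator_of_mem hyS]
            gcongr
            exact hB y hyS
          · rw [indicator_of_notMem hyS, indicator_of_notMem hyS]
            simp [hp0]
      _ ≤ ∫⁻ y, S.indicator (fun _ => ((v⁻¹) ^ (1 / β) * N) ^ p * ENNReal.ofReal B) y :=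
          lintegral_mono' Measure.restrict_le_self le_rfl
      _ = _ := by
          rw [lintegral_indicator hSc.measurableSet, setLIntegral_const,
            ENNReal.mul_rpow_of_nonneg _ _ hp0.le]
          ring

end Basic

/-! ### Smooth cutoff functions -/

-- Convolve the indicator of `A` with a normalized bump supported in the unit ball. The derivative
-- falls on the bump, so its `L¹` norm serves as `C` for every `A`.
open scoped Convolution in
theorem exists_smooth_indicator_unit (n : ℕ) :
    ∃ C : ℝ, 0 ≤ C ∧ ∀ A : Set (E n), MeasurableSet A → ∃ h : E n → ℝ, ContDiff ℝ ∞ h ∧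
      (∀ x, 0 ≤ h x ∧ h x ≤ 1) ∧ (∀ x, ball x 1 ⊆ A → h x = 1) ∧
      (∀ x, Disjoint (ball x 1) A → h x = 0) ∧ ∀ x, ‖fderiv ℝ h x‖ ≤ C := by
  let ρ : ContDiffBump (0 : E n) := ⟨1 / 2, 1, by norm_num, by norm_num⟩
  set f : E n → ℝ := ρ.normed volume with hf
  have hfc : HasCompactSupport f := ρ.hasCompactSupport_normed
  have hfd : ContDiff ℝ ∞ f := ρ.contDiff_normed
  have hfi : Integrable f volume := ρ.integrable_normed
  have hf1 : ∫ t, f t = 1 := ρ.integral_normed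
  have hf0 : ∀ t, 0 ≤ f t := ρ.nonneg_normed
  have hf'i : Integrable (fderiv ℝ f) volume :=
    (hfd.continuous_fderiv (by simp)).integrable_of_hasCompactSupport (hfc.fderiv ℝ)
  refine ⟨∫ t, ‖fderiv ℝ f t‖, integral_nonneg fun _ => norm_nonneg _, fun A hA => ?_⟩
  set g : E n → ℝ := A.indicator fun _ => 1 with hg
  have hgl : LocallyIntegrable g volume := (locallyIntegrable_const 1).indicator hA
  have hgm : Measurable g := measurable_const.indicator hA
  have hg0 : ∀ z, 0 ≤ g z := fun z => indicator_nonneg (fun _ _ => zero_le_one) z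
  have hg1 : ∀ z, g z ≤ 1 := fun z => indicator_le_self' (fun _ _ => zero_le_one) z
  have hgn : ∀ z, ‖g z‖ ≤ 1 := fun z => by rw [Real.norm_of_nonneg (hg0 z)]; exact hg1 z
  refine ⟨f ⋆[ContinuousLinearMap.lsmul ℝ ℝ, volume] g,
    hfc.contDiff_convolution_left _ hfd hgl, fun x => ⟨?_, ?_⟩, fun x hx => ?_, fun x hx => ?_,
    fun x => ?_⟩
  · exact integral_nonneg fun t => mul_nonneg (hf0 t) (hg0 _)
  · calc _ ≤ ∫ t, f t := by
          refine integral_mono_of_nonneg (Eventually.of_forall fun t => mul_nonneg (hf0 t) (hg0 _))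
            hfi (Eventually.of_forall fun t => ?_)
          exact mul_le_of_le_one_right (hf0 t) (hg1 _)
      _ = 1 := hf1
  · have hgx : ∀ z ∈ ball x 1, g z = 1 := fun z hz => indicator_of_mem (hx hz) _
    rw [hf, ρ.normed_convolution_eq_right (fun z hz => ?_), hgx x (mem_ball_self one_pos)]
    rw [hgx z hz, hgx x (mem_ball_self one_pos)]
  · have hgx : ∀ z ∈ ball x 1, g z = 0 :=
      fun z hz => indicator_of_notMem (Set.disjoint_left.1 hx hz) _
    rw [hf, ρ.normed_convolution_eq_right (fun z hz => ?_), hgx x (mem_ball_self one_pos)]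
    rw [hgx z hz, hgx x (mem_ball_self one_pos)]
  · rw [(hfc.hasFDerivAt_convolution_left (ContinuousLinearMap.lsmul ℝ ℝ)
      (hfd.of_le (by simp)) hgl x).fderiv]
    refine norm_integral_le_of_norm_le hf'i.norm (Eventually.of_forall fun t => ?_)
    refine ContinuousLinearMap.opNorm_le_bound _ (norm_nonneg _) fun v => ?_
    simp only [ContinuousLinearMap.precompL_apply, ContinuousLinearMap.lsmul_apply, smul_eq_mul,
      norm_mul]
    calc _ ≤ ‖fderiv ℝ f t v‖ * 1 := by gcongr; exact hgn _
      _ ≤ _ := by rw [mul_one]; exact ContinuousLinearMap.le_opNorm _ _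

theorem exists_smooth_indicator (n : ℕ) :
    ∃ C : ℝ, 0 ≤ C ∧ ∀ (A : Set (E n)) (r : ℝ), MeasurableSet A → 0 < r → ∃ h : E n → ℝ,
      ContDiff ℝ ∞ h ∧ (∀ x, 0 ≤ h x ∧ h x ≤ 1) ∧ (∀ x, ball x r ⊆ A → h x = 1) ∧
      (∀ x, Disjoint (ball x r) A → h x = 0) ∧ ∀ x, ‖fderiv ℝ h x‖ ≤ C / r := by
  obtain ⟨C, hC0, hC⟩ := exists_smooth_indicator_unit n
  refine ⟨C, hC0, fun A r hA hr => ?_⟩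
  obtain ⟨h, hd, hb, h1, h0, hf⟩ := hC ((fun z => r • z) ⁻¹' A)
    (hA.preimage (measurable_const_smul r))
  have hball : ∀ x z : E n, z ∈ ball (r⁻¹ • x) 1 → r • z ∈ ball x r := by
    intro x z hz
    rw [mem_ball, dist_eq_norm] at hz ⊢
    have : r • z - x = r • (z - r⁻¹ • x) := by
      rw [smul_sub, smul_smul, mul_inv_cancel₀ hr.ne', one_smul]
    rw [this, norm_smul, Real.norm_of_nonneg hr.le]
    nlinarith
  refine ⟨fun x => h (r⁻¹ • x), hd.comp (contDiff_const_smul _), fun x => hb _,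
    fun x hx => h1 _ fun z hz => hx (hball x z hz), fun x hx => h0 _ ?_, fun x => ?_⟩
  · exact Set.disjoint_left.2 fun z hz hzA => Set.disjoint_left.1 hx (hball x z hz) hzA
  · rw [fderiv_comp_smul, norm_smul, norm_inv, Real.norm_of_nonneg hr.le, div_eq_inv_mul]
    gcongr
    exact hf _

/-- The cutoff is a product `h * k`, with `h` acting near the boundary at scale `ε` and `k` near
infinity at scale `R`. The derivative of `h` lives where `δ ≤ 3ε`, so `1/ε ≤ 3/δ` there. The
derivative of `k` lives where `‖x‖ ≤ 3R`; since `δ` is at most the distance to a fixed boundary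
point `ξ`, and `‖ξ‖ < R`, again `1/R` is bounded by a multiple of `1/δ`. -/
theorem exists_cutoff {n : ℕ} {Ω : Set (E n)} (hΩ : IsOpen Ω) (hfr : (frontier Ω).Nonempty) :
    ∃ C R₀ : ℝ, 0 ≤ C ∧ 0 < R₀ ∧ ∀ ε R : ℝ, 0 < ε → R₀ ≤ R → ∃ η : E n → ℝ,
      IsTestFunction Ω η ∧ (∀ x, 0 ≤ η x ∧ η x ≤ 1) ∧
      (∀ x ∈ Ω, 3 * ε < bdist Ω x → ‖x‖ < R → η x = 1) ∧
      ∀ x ∈ Ω, ‖fderiv ℝ η x‖ ≤ C * (bdist Ω x)⁻¹ := by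
  obtain ⟨C, hC0, hC⟩ := exists_smooth_indicator n
  obtain ⟨ξ, hξ⟩ := hfr
  refine ⟨8 * C, ‖ξ‖ + 1, by positivity, by positivity, fun ε R hε hR => ?_⟩
  have hξ0 := norm_nonneg ξ
  have hR0 : 0 < R := by linarith
  set A : Set (E n) := {x | x ∈ Ω ∧ 2 * ε < bdist Ω x} with hA
  have hAo : IsOpen A := hΩ.inter (isOpen_lt continuous_const (continuous_bdist Ω))
  obtain ⟨h, hd, hb, h1, h0, hf⟩ := hC A ε hAo.measurableSet hε
  obtain ⟨k, kd, kb, k1, k0, kf⟩ := hC (ball 0 (2 * R)) R measurableSet_ball hR0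
  have hfr' : (frontier Ω).Nonempty := ⟨ξ, hξ⟩
  have h1' : ∀ x ∈ Ω, 3 * ε < bdist Ω x → h x = 1 := by
    intro x hx hxε
    refine h1 x fun z hz => ⟨ball_bdist_subset hΩ hfr' hx ?_, ?_⟩
    · exact ball_subset_ball (by linarith) hz
    · have := bdist_le_add_dist Ω x z
      rw [mem_ball'] at hz
      linarith
  have h0' : ∀ x, ¬ (x ∈ Ω ∧ ε ≤ bdist Ω x) → h x = 0 := by
    intro x hx
    refine h0 x (Set.disjoint_left.2 fun z hz hzA => hx ?_)
    rw [mem_ball'] at hz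
    refine ⟨ball_bdist_subset hΩ hfr' hzA.1 ?_, ?_⟩
    · rw [mem_ball]
      linarith [hzA.2]
    · have := bdist_le_add_dist Ω z x
      rw [dist_comm] at this
      linarith [hzA.2]
  have k1' : ∀ x, ‖x‖ < R → k x = 1 := by
    intro x hx
    refine k1 x (ball_subset_ball' ?_)
    rw [dist_zero_right]
    linarith
  have k0' : ∀ x, 3 * R ≤ ‖x‖ → k x = 0 := by
    intro x hx
    refine k0 x (ball_disjoint_ball ?_)
    rw [dist_zero_right]
    linarith
  have hts : tsupport (fun x => h x * k x) ⊆ {x : E n | x ∈ Ω ∧ ε ≤ bdist Ω x ∧ ‖x‖ ≤ 3 * R} := by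
    refine closure_minimal (fun x hx => ?_) (isCompact_setOf_le_bdist hΩ hε _).isClosed
    have hx1 : h x ≠ 0 := left_ne_zero_of_mul hx
    have hx2 : k x ≠ 0 := right_ne_zero_of_mul hx
    have h3 := not_imp_comm.1 (h0' x) hx1
    have h4 := lt_of_not_ge fun h => hx2 (k0' x h)
    exact ⟨h3.1, h3.2, h4.le⟩
  have hhf : ∀ x ∈ Ω, ‖fderiv ℝ h x‖ ≤ 3 * C * (bdist Ω x)⁻¹ := by
    intro x hx
    have hx0 := bdist_pos hΩ hfr' hx
    by_cases hxε : 3 * ε < bdist Ω x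
    · have he : h =ᶠ[𝓝 x] fun _ => 1 := by
        filter_upwards [hΩ.mem_nhds hx,
          (isOpen_lt continuous_const (continuous_bdist Ω)).mem_nhds hxε] with z hz hzε
        exact h1' z hz hzε
      rw [he.fderiv_eq]
      simp only [fderiv_fun_const, Pi.zero_apply, norm_zero]
      positivity
    · refine (hf x).trans ?_
      rw [mul_comm 3 C, mul_assoc, div_eq_mul_inv]
      gcongr
      rw [← div_eq_mul_inv, le_div_iff₀ hx0, inv_mul_le_iff₀ hε]
      linarith
  have hkf : ∀ x ∈ Ω, ‖fderiv ℝ k x‖ ≤ 5 * C * (bdist Ω x)⁻¹ := by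
    intro x hx
    have hx0 := bdist_pos hΩ hfr' hx
    by_cases hxR : 3 * R < ‖x‖
    · have he : k =ᶠ[𝓝 x] fun _ => 0 := by
        filter_upwards [(isOpen_lt continuous_const continuous_norm).mem_nhds hxR] with z hz
        exact k0' z (le_of_lt hz)
      rw [he.fderiv_eq]
      simp only [fderiv_fun_const, Pi.zero_apply, norm_zero]
      positivity
    · refine (kf x).trans ?_
      rw [mul_comm 5 C, mul_assoc, div_eq_mul_inv]
      gcongr
      rw [← div_eq_mul_inv, le_div_iff₀ hx0, inv_mul_le_iff₀ hR0]
      have h2 : bdist Ω x ≤ dist x ξ := infDist_le_dist_of_mem hξ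
      have h3 : dist x ξ ≤ ‖x‖ + ‖ξ‖ := dist_le_norm_add_norm x ξ
      linarith
  refine ⟨fun x => h x * k x, ⟨hd.mul kd, ?_, hts.trans fun x hx => hx.1⟩,
    fun x => ⟨mul_nonneg (hb x).1 (kb x).1, mul_le_one₀ (hb x).2 (kb x).1 (kb x).2⟩,
    fun x hx hxε hxR => by simp only [h1' x hx hxε, k1' x hxR, one_mul], fun x hx => ?_⟩
  · exact (isCompact_setOf_le_bdist hΩ hε _).of_isClosed_subset (isClosed_tsupport _) hts
  · rw [fderiv_fun_mul (hd.differentiable (by simp) x) (kd.differentiable (by simp) x)]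
    have hn : ∀ a : ℝ, 0 ≤ a ∧ a ≤ 1 → ‖a‖ ≤ 1 := fun a ha => by
      rw [Real.norm_of_nonneg ha.1]; exact ha.2
    calc _ ≤ ‖h x‖ * ‖fderiv ℝ k x‖ + ‖k x‖ * ‖fderiv ℝ h x‖ := by
          rw [← norm_smul, ← norm_smul]
          exact norm_add_le _ _
      _ ≤ 1 * (5 * C * (bdist Ω x)⁻¹) + 1 * (3 * C * (bdist Ω x)⁻¹) := by
          gcongr
          · exact hn _ (hb x)
          · exact hkf x hx
          · exact hn _ (kb x)
          · exact hhf x hx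
      _ = _ := by ring

/-! ### Calculus of weak gradients -/

section WeakGradient

variable {n : ℕ} {Ω : Set (E n)}

theorem inner_gradient_left_eq (φ : E n → ℝ) (x v : E n) :
    inner ℝ (gradient φ x) v = fderiv ℝ φ x v :=
  InnerProductSpace.toDual_symm_apply

theorem norm_gradient (φ : E n → ℝ) (x : E n) : ‖gradient φ x‖ = ‖fderiv ℝ φ x‖ :=
  (InnerProductSpace.toDual ℝ (E n)).symm.norm_map _

theorem continuous_gradient {φ : E n → ℝ} (hφ : ContDiff ℝ ∞ φ) : Continuous (gradient φ) :=
  (InnerProductSpace.toDual ℝ (E n)).symm.continuous.comp (hφ.continuous_fderiv (by simp))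

theorem gradient_eq_zero_of_notMem_tsupport {φ : E n → ℝ} {x : E n} (hx : x ∉ tsupport φ) :
    gradient φ x = 0 := by
  rw [← norm_eq_zero, norm_gradient, norm_eq_zero]
  by_contra h
  exact hx (support_fderiv_subset ℝ h)

theorem IsTestFunction.exists_bound {η : E n → ℝ} (hη : IsTestFunction Ω η) :
    ∃ C, ∀ x, ‖η x‖ ≤ C :=
  hη.compact.exists_bound_of_continuous hη.smooth.continuous

theorem IsTestFunction.exists_bound_gradient {η : E n → ℝ} (hη : IsTestFunction Ω η) :
    ∃ C, ∀ x, ‖gradient η x‖ ≤ C := by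
  obtain ⟨C, hC⟩ := (hη.compact.fderiv ℝ).exists_bound_of_continuous
    (hη.smooth.continuous_fderiv (by simp))
  exact ⟨C, fun x => by rw [norm_gradient]; exact hC x⟩

theorem memLpLoc_one {F : Type*} [NormedAddCommGroup F] {f : E n → F}
    (hf : LocallyIntegrableOn f Ω) : MemLpLoc Ω 1 f := fun K hK hKΩ => by
  rw [ENNReal.ofReal_one, memLp_one_iff_integrable]
  exact hf.integrableOn_compact_subset hKΩ hK

theorem memLp_of_le_mul_of_support_subset {F F' : Type*} [NormedAddCommGroup F]
    [NormedAddCommGroup F'] {β : ℝ} {f : E n → F} (hf : MemLpLoc Ω β f) {K : Set (E n)}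
    (hK : IsCompact K) (hKΩ : K ⊆ Ω) {h : E n → F'} (hhK : ∀ x ∉ K, h x = 0)
    (hh : AEStronglyMeasurable h (volume.restrict K)) {C : ℝ} (hC : ∀ x, ‖h x‖ ≤ C * ‖f x‖) :
    MemLp h (ENNReal.ofReal β) volume := by
  have h1 : MemLp h (ENNReal.ofReal β) (volume.restrict K) :=
    (hf K hK hKΩ).of_le_mul hh (Eventually.of_forall hC)
  rw [← memLp_indicator_iff_restrict hK.measurableSet] at h1
  rwa [indicator_eq_self.2 fun x hx => by_contra fun hxK => hx (hhK x hxK)] at h1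

theorem IsTestFunction.memLp_smul {F : Type*} [NormedAddCommGroup F] [NormedSpace ℝ F] {β : ℝ}
    {η : E n → ℝ} (hη : IsTestFunction Ω η) {f : E n → F} (hf : MemLpLoc Ω β f) :
    MemLp (fun x => η x • f x) (ENNReal.ofReal β) volume := by
  obtain ⟨C, hC⟩ := hη.exists_bound
  refine memLp_of_le_mul_of_support_subset hf hη.compact hη.subset (C := C)
    (fun x hx => by simp [image_eq_zero_of_notMem_tsupport hx])
    (hη.smooth.continuous.aestronglyMeasurable.smul (hf _ hη.compact hη.subset).1) fun x => ?_
  rw [norm_smul]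
  gcongr
  exact hC x

theorem IsTestFunction.memLp_smul_gradient {β : ℝ} {η : E n → ℝ} (hη : IsTestFunction Ω η)
    {u : E n → ℝ} (hu : MemLpLoc Ω β u) :
    MemLp (fun x => u x • gradient η x) (ENNReal.ofReal β) volume := by
  obtain ⟨C, hC⟩ := hη.exists_bound_gradient
  refine memLp_of_le_mul_of_support_subset hu hη.compact hη.subset (C := C)
    (fun x hx => by simp [gradient_eq_zero_of_notMem_tsupport hx])
    ((hu _ hη.compact hη.subset).1.smul
      (continuous_gradient hη.smooth).aestronglyMeasurable) fun x => ?_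
  rw [norm_smul, mul_comm]
  gcongr
  exact hC x

theorem IsTestFunction.integrable_smul {F : Type*} [NormedAddCommGroup F] [NormedSpace ℝ F]
    {η : E n → ℝ} (hη : IsTestFunction Ω η) {f : E n → F} (hf : LocallyIntegrableOn f Ω) :
    Integrable (fun x => η x • f x) volume := by
  have := hη.memLp_smul (memLpLoc_one hf)
  rwa [ENNReal.ofReal_one, memLp_one_iff_integrable] at this

theorem IsTestFunction.integrable_smul_gradient {η : E n → ℝ} (hη : IsTestFunction Ω η)
    {u : E n → ℝ} (hu : LocallyIntegrableOn u Ω) :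
    Integrable (fun x => u x • gradient η x) volume := by
  have := hη.memLp_smul_gradient (memLpLoc_one hu)
  rwa [ENNReal.ofReal_one, memLp_one_iff_integrable] at this

theorem IsTestFunction.integrable_mul_fderiv {η : E n → ℝ} (hη : IsTestFunction Ω η)
    {u : E n → ℝ} (hu : LocallyIntegrableOn u Ω) (v : E n) :
    Integrable (fun x => u x * fderiv ℝ η x v) volume := by
  refine ((hη.integrable_smul_gradient hu).inner_const v).congr (Eventually.of_forall fun x => ?_)
  simp only [real_inner_smul_left, inner_gradient_left_eq]

theorem IsTestFunction.integrable_inner_mul {η : E n → ℝ} (hη : IsTestFunction Ω η)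
    {G : E n → E n} (hG : LocallyIntegrableOn G Ω) (v : E n) :
    Integrable (fun x => inner ℝ (G x) v * η x) volume := by
  refine ((hη.integrable_smul hG).inner_const v).congr (Eventually.of_forall fun x => ?_)
  simp only [real_inner_smul_left, mul_comm]

theorem IsTestFunction.setIntegral_eq {F : Type*} [NormedAddCommGroup F] [NormedSpace ℝ F]
    {η : E n → ℝ} (hη : IsTestFunction Ω η) {f : E n → F} (hf : ∀ x ∉ tsupport η, f x = 0) :
    ∫ x in Ω, f x = ∫ x, f x :=
  setIntegral_eq_integral_of_forall_compl_eq_zero fun x hx => hf x fun h => hx (hη.subset h)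

theorem fderiv_apply_eq_zero_of_notMem_tsupport {η : E n → ℝ} {x : E n} (hx : x ∉ tsupport η)
    (v : E n) : fderiv ℝ η x v = 0 := by
  rw [← inner_gradient_left_eq, gradient_eq_zero_of_notMem_tsupport hx, inner_zero_left]

/-- Both integrands vanish off the support of `φ`, so the identity may be used on the whole space,
where convolution and integration by parts are available. -/
theorem HasWeakGradient.integral_eq' {u : E n → ℝ} {G : E n → E n} (h : HasWeakGradient Ω u G)
    {φ : E n → ℝ} (hφ : IsTestFunction Ω φ) (v : E n) :
    ∫ x, u x * fderiv ℝ φ x v = - ∫ x, inner ℝ (G x) v * φ x := by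
  rw [← hφ.setIntegral_eq fun x hx => by rw [fderiv_apply_eq_zero_of_notMem_tsupport hx, mul_zero],
    ← hφ.setIntegral_eq fun x hx => by rw [image_eq_zero_of_notMem_tsupport hx, mul_zero]]
  exact h.integral_eq φ hφ v

theorem HasWeakGradient.of_integral_eq {u : E n → ℝ} {G : E n → E n}
    (hu : LocallyIntegrableOn u Ω) (hG : LocallyIntegrableOn G Ω)
    (h : ∀ φ : E n → ℝ, IsTestFunction Ω φ → ∀ v : E n,
      ∫ x, u x * fderiv ℝ φ x v = - ∫ x, inner ℝ (G x) v * φ x) : HasWeakGradient Ω u G := by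
  refine ⟨hu, hG, fun φ hφ v => ?_⟩
  rw [hφ.setIntegral_eq fun x hx => by rw [fderiv_apply_eq_zero_of_notMem_tsupport hx, mul_zero],
    hφ.setIntegral_eq fun x hx => by rw [image_eq_zero_of_notMem_tsupport hx, mul_zero]]
  exact h φ hφ v

theorem hasWeakGradient_of_contDiff {f : E n → ℝ} (hf : ContDiff ℝ ∞ f) :
    HasWeakGradient Ω f (gradient f) := by
  have hfl : LocallyIntegrable f volume := hf.continuous.locallyIntegrable
  have hgl : LocallyIntegrable (gradient f) volume := (continuous_gradient hf).locallyIntegrable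
  refine .of_integral_eq (hfl.locallyIntegrableOn Ω) (hgl.locallyIntegrableOn Ω) fun φ hφ v => ?_
  have h1 := hφ.integrable_inner_mul (hgl.locallyIntegrableOn Ω) v
  have h2 := hφ.integrable_mul_fderiv (hfl.locallyIntegrableOn Ω) v
  have h3 := hφ.integrable_smul (hfl.locallyIntegrableOn Ω)
  simp only [inner_gradient_left_eq] at h1 ⊢
  refine integral_mul_fderiv_eq_neg_fderiv_mul_of_integrable h1 h2 ?_
    (fun x _ => hf.differentiable (by simp) x) (fun x _ => hφ.smooth.differentiable (by simp) x)
  simpa only [smul_eq_mul, mul_comm] using h3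

theorem HasWeakGradient.sub {u w : E n → ℝ} {G H : E n → E n} (hu : HasWeakGradient Ω u G)
    (hw : HasWeakGradient Ω w H) : HasWeakGradient Ω (u - w) (G - H) := by
  refine .of_integral_eq (hu.integrable.sub hw.integrable)
    (hu.integrable_grad.sub hw.integrable_grad) fun φ hφ v => ?_
  simp only [Pi.sub_apply, sub_mul, inner_sub_left]
  rw [integral_sub (hφ.integrable_mul_fderiv hu.integrable v)
      (hφ.integrable_mul_fderiv hw.integrable v),
    integral_sub (hφ.integrable_inner_mul hu.integrable_grad v)
      (hφ.integrable_inner_mul hw.integrable_grad v), hu.integral_eq' hφ, hw.integral_eq' hφ]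
  ring

/-- The fundamental lemma of the calculus of variations, applied to `G - H` and tested against each
vector `v`. -/
theorem HasWeakGradient.ae_eq {u : E n → ℝ} {G H : E n → E n} (hΩ : IsOpen Ω)
    (hG : HasWeakGradient Ω u G) (hH : HasWeakGradient Ω u H) :
    G =ᵐ[volume.restrict Ω] H := by
  have h := hΩ.ae_eq_zero_of_integral_contDiff_smul_eq_zero (μ := volume)
    (hG.integrable_grad.sub hH.integrable_grad) fun φ hφ hc hs => by
    have ht : IsTestFunction Ω φ := ⟨hφ, hc, hs⟩
    have hi : Integrable (fun x => φ x • (G - H) x) volume :=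
      ht.integrable_smul (hG.integrable_grad.sub hH.integrable_grad)
    refine ext_inner_right ℝ fun v => ?_
    rw [inner_zero_left, real_inner_comm, ← integral_inner hi]
    have h1 := hG.integral_eq' ht v
    rw [hH.integral_eq' ht v, neg_inj] at h1
    have h2 : ∀ x, inner ℝ v (φ x • (G - H) x) = inner ℝ (G x) v * φ x - inner ℝ (H x) v * φ x := by
      intro x
      rw [real_inner_comm, real_inner_smul_left, Pi.sub_apply, inner_sub_left]
      ring
    simp only [h2]
    rw [integral_sub (ht.integrable_inner_mul hG.integrable_grad v)
      (ht.integrable_inner_mul hH.integrable_grad v), h1, sub_self]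
  rw [EventuallyEq, ae_restrict_iff' hΩ.measurableSet]
  filter_upwards [h] with x hx hxΩ
  exact sub_eq_zero.1 (hx hxΩ)

/-- The product rule: cutting off a function with a weak gradient in `Ω` by a test function gives
a function with a weak gradient in the whole space. -/
theorem HasWeakGradient.mul_testFunction {u : E n → ℝ} {G : E n → E n}
    (hu : HasWeakGradient Ω u G) {η : E n → ℝ} (hη : IsTestFunction Ω η) :
    HasWeakGradient univ (fun x => η x • u x) (fun x => η x • G x + u x • gradient η x) := by
  refine .of_integral_eq ((hη.integrable_smul hu.integrable).locallyIntegrable.locallyIntegrableOn _)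
    (((hη.integrable_smul hu.integrable_grad).add
      (hη.integrable_smul_gradient hu.integrable)).locallyIntegrable.locallyIntegrableOn _)
    fun φ hφ v => ?_
  -- Although `φ` need not be supported in `Ω`, the product `ηφ` is, so it may be inserted in the
  -- weak identity for `u`; the term with `∇η` then moves to the other side.
  have ht : IsTestFunction Ω (fun x => η x * φ x) :=
    ⟨hη.smooth.mul hφ.smooth, hη.compact.mul_right, (tsupport_mul_subset_left).trans hη.subset⟩
  have hη' : IsTestFunction univ η := ⟨hη.smooth, hη.compact, subset_univ _⟩
  have hi1 := hφ.integrable_mul_fderiv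
    ((hη.integrable_smul hu.integrable).locallyIntegrable.locallyIntegrableOn univ) v
  have hi2 := hφ.integrable_inner_mul
    ((hη.integrable_smul_gradient hu.integrable).locallyIntegrable.locallyIntegrableOn univ) v
  have hi3 := hφ.integrable_inner_mul
    ((hη.integrable_smul hu.integrable_grad).locallyIntegrable.locallyIntegrableOn univ) v
  have h := hu.integral_eq' ht v
  have e1 : ∀ x, u x * fderiv ℝ (fun x => η x * φ x) x v =
      η x • u x * fderiv ℝ φ x v + inner ℝ (u x • gradient η x) v * φ x := by
    intro x
    rw [fderiv_fun_mul (hη.smooth.differentiable (by simp) x)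
      (hφ.smooth.differentiable (by simp) x), real_inner_smul_left, inner_gradient_left_eq]
    simp only [add_apply, smul_apply, smul_eq_mul]
    ring
  have e2 : ∀ x, inner ℝ (G x) v * (η x * φ x) = inner ℝ (η x • G x) v * φ x := by
    intro x
    rw [real_inner_smul_left]
    ring
  simp only [e1, e2] at h
  rw [integral_add hi1 hi2] at h
  simp only [inner_add_left, add_mul]
  rw [integral_add hi3 hi2]
  linarith

end WeakGradient

open scoped Convolution

/-! ### Mollification in `L^β` -/

section Mollification

variable {n : ℕ} {F : Type*} [NormedAddCommGroup F] [NormedSpace ℝ F]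

/-- The bump is the density of a probability measure `ν`. Jensen's inequality, in the form `L¹(ν) ≤
L^β(ν)`, bounds the convolution pointwise; Tonelli and translation invariance finish. -/
theorem eLpNorm_convolution_normed_le {β : ℝ} (hβ : 1 ≤ β) (φ : ContDiffBump (0 : E n))
    {f : E n → F} (hf : AEStronglyMeasurable f volume) :
    eLpNorm (φ.normed volume ⋆[ContinuousLinearMap.lsmul ℝ ℝ, volume] f) (ENNReal.ofReal β) volume ≤
      eLpNorm f (ENNReal.ofReal β) volume := by
  obtain ⟨g, hg, hfg⟩ := hf
  rw [convolution_congr _ (EventuallyEq.refl _ _) hfg, eLpNorm_congr_ae hfg]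
  have hβ0 : 0 < β := by linarith
  set ρ : E n → ℝ := φ.normed volume with hρ
  have hρ0 : ∀ t, 0 ≤ ρ t := φ.nonneg_normed
  have hρm : Measurable fun t => ENNReal.ofReal (ρ t) :=
    φ.continuous_normed.measurable.ennreal_ofReal
  set ν : Measure (E n) := volume.withDensity fun t => ENNReal.ofReal (ρ t) with hν
  have hν1 : ν univ = 1 := by
    rw [hν, withDensity_apply _ MeasurableSet.univ, Measure.restrict_univ,
      ← ofReal_integral_eq_lintegral_ofReal φ.integrable_normed (Eventually.of_forall hρ0),
      φ.integral_normed, ENNReal.ofReal_one]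
  have hνp : IsProbabilityMeasure ν := ⟨hν1⟩
  have hpt : ∀ x, ‖(ρ ⋆[ContinuousLinearMap.lsmul ℝ ℝ, volume] g) x‖ₑ ^ β ≤
      ∫⁻ t, ‖g (x - t)‖ₑ ^ β ∂ν := by
    intro x
    have hgm : StronglyMeasurable fun t => g (x - t) := hg.comp_measurable (by fun_prop)
    have h1 : ‖(ρ ⋆[ContinuousLinearMap.lsmul ℝ ℝ, volume] g) x‖ₑ ≤ ∫⁻ t, ‖g (x - t)‖ₑ ∂ν := by
      refine (enorm_integral_le_lintegral_enorm _).trans ?_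
      rw [hν, lintegral_withDensity_eq_lintegral_mul _ hρm hgm.enorm]
      refine lintegral_mono fun t => ?_
      simp only [ContinuousLinearMap.lsmul_apply, enorm_smul, Pi.mul_apply]
      rw [Real.enorm_of_nonneg (hρ0 t)]
    have h2 := eLpNorm_le_eLpNorm_of_exponent_le (μ := ν) (p := 1) (q := ENNReal.ofReal β)
      (by simpa using hβ) hgm.aestronglyMeasurable
    rw [eLpNorm_one_eq_lintegral_enorm, eLpNorm_eq_lintegral_rpow_enorm_toReal (by simp [hβ0])
      (by simp), ENNReal.toReal_ofReal hβ0.le] at h2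
    calc _ ≤ ((∫⁻ t, ‖g (x - t)‖ₑ ^ β ∂ν) ^ (1 / β)) ^ β :=
          ENNReal.rpow_le_rpow (h1.trans h2) hβ0.le
      _ = _ := by rw [← ENNReal.rpow_mul, one_div_mul_cancel hβ0.ne', ENNReal.rpow_one]
  rw [eLpNorm_eq_lintegral_rpow_enorm_toReal (by simp [hβ0]) (by simp),
    eLpNorm_eq_lintegral_rpow_enorm_toReal (by simp [hβ0]) (by simp),
    ENNReal.toReal_ofReal hβ0.le]
  refine ENNReal.rpow_le_rpow ?_ (by positivity)
  refine (lintegral_mono hpt).trans ?_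
  have hm : Measurable (Function.uncurry fun x t : E n => ‖g (x - t)‖ₑ ^ β) :=
    ((hg.enorm.comp (measurable_fst.sub measurable_snd)).pow_const β)
  rw [lintegral_lintegral_swap hm.aemeasurable]
  have ht : ∀ t : E n, ∫⁻ x, ‖g (x - t)‖ₑ ^ β = ∫⁻ x, ‖g x‖ₑ ^ β := fun t =>
    lintegral_sub_right_eq_self (fun x => ‖g x‖ₑ ^ β) t
  simp only [ht, lintegral_const, hν1, mul_one, le_refl]

/-- Approximate `f` by a continuous compactly supported `g`. Mollification does not increase the
error `f - g`, and it moves `g` uniformly little by uniform continuity. -/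
theorem exists_eLpNorm_convolution_sub_le [CompleteSpace F] {β : ℝ} (hβ : 1 ≤ β) {f : E n → F}
    (hf : MemLp f (ENNReal.ofReal β) volume) {δ : ℝ≥0∞} (hδ : δ ≠ 0) :
    ∃ r₀ : ℝ, 0 < r₀ ∧ ∀ φ : ContDiffBump (0 : E n), φ.rOut < r₀ →
      eLpNorm (φ.normed volume ⋆[ContinuousLinearMap.lsmul ℝ ℝ, volume] f - f)
        (ENNReal.ofReal β) volume ≤ δ := by
  have hβ0 : 0 < β := by linarith
  have hβ1 : 1 ≤ ENNReal.ofReal β := by simpa using hβ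
  have hδ3 : δ / 3 ≠ 0 := by simp [hδ]
  obtain ⟨g, hgc, hfg, hg, hgL⟩ :=
    hf.exists_hasCompactSupport_eLpNorm_sub_le ENNReal.ofReal_ne_top hδ3
  set K := cthickening 1 (tsupport g) with hK
  have hKc : IsCompact K := hgc.isCompact.cthickening
  set V : ℝ≥0∞ := volume K ^ (1 / (ENNReal.ofReal β).toReal) with hV
  have hVtop : V ≠ ⊤ := ENNReal.rpow_ne_top_of_nonneg (by positivity) hKc.measure_lt_top.ne
  obtain ⟨κ, hκ0, hκ⟩ := ENNReal.exists_nnreal_pos_mul_lt hVtop hδ3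
  obtain ⟨r, hr0, hr⟩ := Metric.uniformContinuous_iff.1
    (hgc.uniformContinuous_of_continuous hg) κ hκ0
  -- The bound `1` keeps the mollified `g` supported in `K`, and `κ` was chosen so that a uniform
  -- error `κ` on `K` costs at most `δ / 3` in `L^β`.
  refine ⟨min r 1, by positivity, fun φ hφ => ?_⟩
  have hφr : φ.rOut < r := hφ.trans_le (min_le_left _ _)
  have hφ1 : φ.rOut < 1 := hφ.trans_le (min_le_right _ _)
  set ρ : E n → ℝ := φ.normed volume with hρ
  have hfl : LocallyIntegrable f volume := hf.locallyIntegrable hβ1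
  have hgl : LocallyIntegrable g volume := hg.locallyIntegrable
  have hex : ∀ h : E n → F, LocallyIntegrable h volume →
      ConvolutionExists ρ h (ContinuousLinearMap.lsmul ℝ ℝ) volume := fun h hh =>
    φ.hasCompactSupport_normed.convolutionExists_left _ φ.continuous_normed hh
  have hgdiff : eLpNorm (ρ ⋆[ContinuousLinearMap.lsmul ℝ ℝ, volume] g - g)
      (ENNReal.ofReal β) volume ≤ δ / 3 := by
    have hb : ∀ x, ‖(ρ ⋆[ContinuousLinearMap.lsmul ℝ ℝ, volume] g - g) x‖ ≤
        ‖K.indicator (fun _ => (κ : ℝ)) x‖ := by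
      intro x
      rw [Pi.sub_apply, ← dist_eq_norm]
      by_cases hx : x ∈ K
      · rw [indicator_of_mem hx, Real.norm_of_nonneg κ.coe_nonneg]
        exact φ.dist_normed_convolution_le hg.aestronglyMeasurable fun z hz =>
          (hr (lt_trans hz hφr)).le
      · have hz : ∀ z ∈ ball x φ.rOut, g z = 0 := fun z hz => by
          by_contra hgz
          refine hx (mem_cthickening_of_dist_le x z 1 _ (subset_tsupport g hgz) ?_)
          rw [mem_ball'] at hz
          linarith
        have hx0 := hz x (mem_ball_self φ.rOut_pos)
        rw [hρ, φ.normed_convolution_eq_right fun z hz' => by rw [hz z hz', hx0], dist_self]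
        exact norm_nonneg _
    refine (eLpNorm_mono hb).trans ?_
    rw [eLpNorm_indicator_const hKc.measurableSet (by simp [hβ0]) (by simp)]
    simpa [hV] using hκ.le
  have hsum : ρ ⋆[ContinuousLinearMap.lsmul ℝ ℝ, volume] f - f =
      ρ ⋆[ContinuousLinearMap.lsmul ℝ ℝ, volume] (f - g) +
        (ρ ⋆[ContinuousLinearMap.lsmul ℝ ℝ, volume] g - g) + (g - f) := by
    have h1 := (hex _ (hfl.sub hgl)).distrib_add (hex g hgl)
    rw [sub_add_cancel] at h1
    rw [h1]
    abel
  have hcont : ∀ h : E n → F, LocallyIntegrable h volume →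
      AEStronglyMeasurable (ρ ⋆[ContinuousLinearMap.lsmul ℝ ℝ, volume] h) volume := fun h hh =>
    (φ.hasCompactSupport_normed.continuous_convolution_left _
      φ.continuous_normed hh).aestronglyMeasurable
  have hm1 := hcont _ (hfl.sub hgl)
  have hm2 := (hcont g hgl).sub hg.aestronglyMeasurable
  rw [hsum]
  calc _ ≤ δ / 3 + δ / 3 + δ / 3 := by
        refine (eLpNorm_add_le (hm1.add hm2) (hg.aestronglyMeasurable.sub hf.1) hβ1).trans ?_
        gcongr
        · refine (eLpNorm_add_le hm1 hm2 hβ1).trans ?_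
          gcongr
          exact (eLpNorm_convolution_normed_le hβ φ (hf.1.sub hg.aestronglyMeasurable)).trans hfg
        · rw [eLpNorm_sub_comm]
          exact hfg
    _ = δ := ENNReal.add_thirds δ

end Mollification

open scoped Convolution

/-! ### Approximation by test functions -/

section Approximation

variable {n : ℕ} {Ω : Set (E n)}

theorem gradient_convolution_normed (φ : ContDiffBump (0 : E n)) {v : E n → ℝ} {H : E n → E n}
    (h : HasWeakGradient univ v H) :
    gradient (φ.normed volume ⋆[ContinuousLinearMap.lsmul ℝ ℝ, volume] v) =
      φ.normed volume ⋆[ContinuousLinearMap.lsmul ℝ ℝ, volume] H := by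
  have hvl : LocallyIntegrable v volume := locallyIntegrableOn_univ.1 h.integrable
  have hHl : LocallyIntegrable H volume := locallyIntegrableOn_univ.1 h.integrable_grad
  set ρ : E n → ℝ := φ.normed volume with hρ
  have hρd : ContDiff ℝ ∞ ρ := φ.contDiff_normed
  have hρc : HasCompactSupport ρ := φ.hasCompactSupport_normed
  have hex := hρc.convolutionExists_left (ContinuousLinearMap.lsmul ℝ ℝ) hρd.continuous hHl
  have hex' := (hρc.fderiv ℝ).convolutionExists_left
    ((ContinuousLinearMap.lsmul ℝ ℝ).precompL (E n)) (hρd.continuous_fderiv (by simp)) hvl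
  ext1 x
  refine ext_inner_right ℝ fun w => ?_
  -- Testing the weak identity against the reflected and translated bump gives the claim; its
  -- derivative carries a sign that cancels the one in the weak identity.
  have hψ : IsTestFunction univ fun t => ρ (x - t) :=
    ⟨hρd.comp (contDiff_const.sub contDiff_id),
      hρc.comp_homeomorph (Homeomorph.subLeft x), subset_univ _⟩
  have hfd : ∀ t, fderiv ℝ (fun t => ρ (x - t)) t w = - fderiv ℝ ρ (x - t) w := by
    intro t
    have h1 : HasFDerivAt (fun t => ρ (x - t)) _ t :=
      (hρd.differentiable (by simp) (x - t)).hasFDerivAt.comp t ((hasFDerivAt_id t).const_sub x)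
    rw [h1.fderiv]
    simp
  have hw := h.integral_eq' hψ w
  simp only [hfd, mul_neg, integral_neg, neg_inj] at hw
  rw [inner_gradient_left_eq, (hρc.hasFDerivAt_convolution_left (ContinuousLinearMap.lsmul ℝ ℝ)
    (hρd.of_le (by simp)) hvl x).fderiv]
  have hl : (fderiv ℝ ρ ⋆[(ContinuousLinearMap.lsmul ℝ ℝ).precompL (E n), volume] v) x w =
      ∫ t, fderiv ℝ ρ t w * v (x - t) := by
    rw [convolution_def, ContinuousLinearMap.integral_apply (hex' x)]
    rfl
  have hr : inner ℝ ((ρ ⋆[ContinuousLinearMap.lsmul ℝ ℝ, volume] H) x) w =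
      ∫ t, inner ℝ (H (x - t)) w * ρ t := by
    rw [convolution_def, real_inner_comm, ← integral_inner (hex x)]
    refine integral_congr_ae (Eventually.of_forall fun t => ?_)
    simp only [ContinuousLinearMap.lsmul_apply]
    rw [real_inner_comm, real_inner_smul_left, mul_comm]
  rw [hl, hr, ← integral_sub_left_eq_self _ volume x,
    ← integral_sub_left_eq_self (fun t => inner ℝ (H (x - t)) w * ρ t) volume x]
  simp only [sub_sub_cancel]
  rw [← hw]
  simp only [mul_comm]

theorem convolution_normed_eq_zero {F : Type*} [NormedAddCommGroup F] [NormedSpace ℝ F]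
    [CompleteSpace F] (φ : ContDiffBump (0 : E n)) {f : E n → F} {K : Set (E n)}
    (hf : Function.support f ⊆ K) {r : ℝ} (hr : φ.rOut ≤ r) {x : E n} (hx : x ∉ cthickening r K) :
    (φ.normed volume ⋆[ContinuousLinearMap.lsmul ℝ ℝ, volume] f) x = 0 := by
  have hz : ∀ z ∈ ball x φ.rOut, f z = 0 := fun z hz => by
    by_contra hfz
    refine hx (mem_cthickening_of_dist_le x z r _ (hf hfz) ?_)
    rw [mem_ball'] at hz
    linarith
  have hx0 := hz x (mem_ball_self φ.rOut_pos)
  rw [φ.normed_convolution_eq_right fun z hz' => by rw [hz z hz', hx0], hx0]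

/-- Compactly supported Sobolev functions are approximated by test functions. -/
theorem exists_testFunction_near_of_compactSupport (hΩ : IsOpen Ω) (hfr : (frontier Ω).Nonempty)
    {d p c β s : ℝ} (hp : 1 ≤ p) (hc : 0 < c) (hc1 : c < 1) (hβ : 1 ≤ β) {K : Set (E n)}
    (hK : IsCompact K) (hKΩ : K ⊆ Ω) {v : E n → ℝ} {H : E n → E n}
    (h : HasWeakGradient univ v H) (hvL : MemLp v (ENNReal.ofReal β) volume)
    (hHL : MemLp H (ENNReal.ofReal β) volume) (hvK : Function.support v ⊆ K)
    (hHK : Function.support H ⊆ K) {ε : ℝ≥0∞} (hε : ε ≠ 0) :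
    ∃ φ : E n → ℝ, IsTestFunction Ω φ ∧ lebesgueNorm Ω d p c β s (H - gradient φ) < ε ∧
      lebesgueNorm Ω d p c β (s + 1) (v - φ) < ε := by
  -- Mollifying at scale at most `r` keeps both errors supported in one compact subset of `Ω`, so
  -- the constants `C₁`, `C₂` do not depend on the scale.
  obtain ⟨r, hr0, hr⟩ := hK.exists_cthickening_subset_open hΩ hKΩ
  have hK' : IsCompact (cthickening r K) := hK.cthickening
  obtain ⟨C₁, hC₁, hb₁⟩ := exists_lebesgueNorm_le_eLpNorm (d := d) (p := p) (s := s)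
    (F := E n) hΩ hfr hp hc hc1 hβ hK' hr
  obtain ⟨C₂, hC₂, hb₂⟩ := exists_lebesgueNorm_le_eLpNorm (d := d) (p := p) (s := s + 1)
    (F := ℝ) hΩ hfr hp hc hc1 hβ hK' hr
  obtain ⟨δ₁, hδ₁, hδC₁⟩ := ENNReal.exists_nnreal_pos_mul_lt hC₁ hε
  obtain ⟨δ₂, hδ₂, hδC₂⟩ := ENNReal.exists_nnreal_pos_mul_lt hC₂ hε
  obtain ⟨r₁, hr₁, hm₁⟩ := exists_eLpNorm_convolution_sub_le hβ hHL
    (ENNReal.coe_ne_zero.2 hδ₁.ne')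
  obtain ⟨r₂, hr₂, hm₂⟩ := exists_eLpNorm_convolution_sub_le hβ hvL
    (ENNReal.coe_ne_zero.2 hδ₂.ne')
  obtain ⟨a, ha0, ha⟩ := exists_between (lt_min hr0 (lt_min hr₁ hr₂))
  let φ : ContDiffBump (0 : E n) := ⟨a / 2, a, by positivity, by linarith⟩
  have har : φ.rOut ≤ r := (ha.trans_le (min_le_left _ _)).le
  have har₁ : φ.rOut < r₁ := ha.trans_le ((min_le_right _ _).trans (min_le_left _ _))
  have har₂ : φ.rOut < r₂ := ha.trans_le ((min_le_right _ _).trans (min_le_right _ _))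
  have hKr : K ⊆ cthickening r K := self_subset_cthickening K
  have hts : tsupport (φ.normed volume ⋆[ContinuousLinearMap.lsmul ℝ ℝ, volume] v) ⊆
      cthickening r K := closure_minimal (fun x hx => by
    by_contra hxK
    exact hx (convolution_normed_eq_zero φ hvK har hxK)) isClosed_cthickening
  refine ⟨φ.normed volume ⋆[ContinuousLinearMap.lsmul ℝ ℝ, volume] v,
    ⟨φ.hasCompactSupport_normed.contDiff_convolution_left _ φ.contDiff_normed
      (locallyIntegrableOn_univ.1 h.integrable),
      hK'.of_isClosed_subset (isClosed_tsupport _) hts, hts.trans hr⟩, ?_, ?_⟩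
  · rw [gradient_convolution_normed φ h]
    refine (hb₁ _ fun x hx => ?_).trans_lt (lt_of_le_of_lt ?_ hδC₁)
    · by_contra hxK
      refine hx ?_
      rw [Pi.sub_apply, convolution_normed_eq_zero φ hHK har hxK, sub_zero]
      exact by_contra fun h0 => hxK (hKr (hHK h0))
    · rw [mul_comm, eLpNorm_sub_comm]
      gcongr
      exact hm₁ φ har₁
  · refine (hb₂ _ fun x hx => ?_).trans_lt (lt_of_le_of_lt ?_ hδC₂)
    · by_contra hxK
      refine hx ?_
      rw [Pi.sub_apply, convolution_normed_eq_zero φ hvK har hxK, sub_zero]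
      exact by_contra fun h0 => hxK (hKr (hvK h0))
    · rw [mul_comm, eLpNorm_sub_comm]
      gcongr
      exact hm₂ φ har₂

theorem IsTestFunction.memTraceless (hΩ : IsOpen Ω) (hfr : (frontier Ω).Nonempty)
    {d p c β s : ℝ} (hp : 1 ≤ p) (hc : 0 < c) (hc1 : c < 1) (hβ : 1 ≤ β) {φ : E n → ℝ}
    (hφ : IsTestFunction Ω φ) : MemTraceless Ω d p c β s φ := by
  have hgs : Function.support (gradient φ) ⊆ tsupport φ := fun x hx =>
    by_contra fun h => hx (gradient_eq_zero_of_notMem_tsupport h)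
  have hgc : HasCompactSupport (gradient φ) := .of_support_subset_isCompact hφ.compact hgs
  obtain ⟨C₁, hC₁, hb₁⟩ := exists_lebesgueNorm_le_eLpNorm (d := d) (p := p) (s := s)
    (F := E n) hΩ hfr hp hc hc1 hβ hφ.compact hφ.subset
  obtain ⟨C₂, hC₂, hb₂⟩ := exists_lebesgueNorm_le_eLpNorm (d := d) (p := p) (s := s + 1)
    (F := ℝ) hΩ hfr hp hc hc1 hβ hφ.compact hφ.subset
  have hg := continuous_gradient hφ.smooth
  have hw : HasWeakGradient Ω φ (gradient φ) := hasWeakGradient_of_contDiff hφ.smooth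
  refine ⟨⟨⟨gradient φ, hw, fun K _ _ => hg.memLp_of_hasCompactSupport hgc⟩, ?_⟩,
    fun K _ _ => hφ.smooth.continuous.memLp_of_hasCompactSupport hφ.compact, ?_⟩
  · refine (iInf₂_le (gradient φ) hw).trans_lt ((hb₁ _ hgs).trans_lt ?_)
    exact ENNReal.mul_lt_top hC₁.lt_top (hg.memLp_of_hasCompactSupport hgc).2
  · refine (hb₂ _ (subset_tsupport φ)).trans_lt ?_
    exact ENNReal.mul_lt_top hC₂.lt_top
      (hφ.smooth.continuous.memLp_of_hasCompactSupport hφ.compact).2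

/-- Local `L^β` integrability and finiteness of the norm may be witnessed by different versions of
the weak gradient; uniqueness almost everywhere transfers the first to the second. -/
theorem MemSobolev.exists_weakGradient (hΩ : IsOpen Ω) {d p c β s : ℝ} {u : E n → ℝ}
    (hu : MemSobolev Ω d p c β s u) : ∃ G : E n → E n, HasWeakGradient Ω u G ∧ MemLpLoc Ω β G ∧
      lebesgueNorm Ω d p c β s G < ⊤ := by
  obtain ⟨⟨G₀, hG₀, hL⟩, hlt⟩ := hu
  simp only [sobolevNorm, iInf_lt_iff] at hlt
  obtain ⟨G, hG, hlt⟩ := hlt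
  exact ⟨G, hG, fun K hK hKΩ => (memLp_congr_ae (ae_restrict_of_ae_restrict_of_subset hKΩ
    (hG₀.ae_eq hΩ hG))).1 (hL K hK hKΩ), hlt⟩

theorem eventually_whitneyBall_subset (hΩ : IsOpen Ω) (hfr : (frontier Ω).Nonempty) {c : ℝ}
    (hc1 : c < 1) (R : ℝ) {y : E n} (hy : y ∈ Ω) :
    ∀ᶠ k : ℕ in atTop, ball y (c * bdist Ω y) ⊆
      {x | x ∈ Ω ∧ 3 * (1 / ((k : ℝ) + 1)) < bdist Ω x ∧ ‖x‖ < R + k} := by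
  have hy0 := bdist_pos hΩ hfr hy
  have h1 : Tendsto (fun k : ℕ => 3 * (1 / ((k : ℝ) + 1))) atTop (𝓝 (3 * 0)) :=
    tendsto_one_div_add_atTop_nhds_zero_nat.const_mul 3
  rw [mul_zero] at h1
  have h2 : Tendsto (fun k : ℕ => R + (k : ℝ)) atTop atTop :=
    tendsto_atTop_add_const_left _ _ tendsto_natCast_atTop_atTop
  filter_upwards [h1.eventually (gt_mem_nhds (mul_pos (sub_pos.2 hc1) hy0)),
    h2.eventually_ge_atTop (‖y‖ + c * bdist Ω y)] with k hk1 hk2 z hz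
  refine ⟨whitneyBall_subset hΩ hfr hc1 hy hz, ?_, ?_⟩
  · have := bdist_le_add_dist Ω y z
    rw [mem_ball'] at hz
    linarith
  · have h6 : ‖z‖ ≤ ‖y‖ + dist z y := by
      rw [dist_eq_norm]
      simpa using norm_add_le y (z - y)
    rw [mem_ball] at hz
    linarith

/-- Cutting off near the boundary and near infinity approximates `u` in the traceless space. -/
theorem exists_cutoff_near (hΩ : IsOpen Ω) (hfr : (frontier Ω).Nonempty) {d p c β s : ℝ}
    (hp : 1 ≤ p) (hc : 0 < c) (hc1 : c < 1) (hβ : 1 ≤ β) {u : E n → ℝ} {G : E n → E n}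
    (hG : HasWeakGradient Ω u G) (hGn : lebesgueNorm Ω d p c β s G < ⊤)
    (hun : lebesgueNorm Ω d p c β (s + 1) u < ⊤) {ε : ℝ≥0∞} (hε : 0 < ε) :
    ∃ η : E n → ℝ, IsTestFunction Ω η ∧
      lebesgueNorm Ω d p c β s (G - fun x => η x • G x + u x • gradient η x) < ε ∧
      lebesgueNorm Ω d p c β (s + 1) (u - fun x => η x • u x) < ε := by
  obtain ⟨C, R, hC0, hR0, hC⟩ := exists_cutoff hΩ hfr
  set K : ℕ → Set (E n) := fun k =>
    {x | x ∈ Ω ∧ 3 * (1 / ((k : ℝ) + 1)) < bdist Ω x ∧ ‖x‖ < R + k} with hK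
  have hKo : ∀ k, IsOpen (K k) := fun k =>
    hΩ.inter ((isOpen_lt continuous_const (continuous_bdist Ω)).inter
      (isOpen_lt continuous_norm continuous_const))
  have hKm : ∀ k, MeasurableSet (K k) := fun k => (hKo k).measurableSet
  have hGm : AEMeasurable (fun z => ‖G z‖ₑ) (volume.restrict Ω) :=
    hG.integrable_grad.aestronglyMeasurable.enorm
  have hum : AEMeasurable (fun z => ‖u z‖ₑ) (volume.restrict Ω) :=
    hG.integrable.aestronglyMeasurable.enorm
  set q : E n → ℝ≥0∞ := fun z => ENNReal.ofReal (bdist Ω z)⁻¹ * ‖u z‖ₑ with hq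
  have hqm : AEMeasurable q (volume.restrict Ω) :=
    (continuous_bdist Ω).measurable.inv.ennreal_ofReal.aemeasurable.mul hum
  -- A majorant for the gradient error, independent of the cutoff.
  set g : E n → ℝ≥0∞ := fun z => ‖G z‖ₑ + ENNReal.ofReal C * q z with hg
  have hgm : AEMeasurable g (volume.restrict Ω) := hGm.add (hqm.const_mul _)
  have hgn : lebesgueNormENN Ω d p c β s g ≠ ⊤ := by
    refine ((lebesgueNormENN_add_le hΩ hfr hp hc1 hβ hGm (hqm.const_mul _)).trans_lt
      (ENNReal.add_lt_top.2 ⟨hGn, ?_⟩)).ne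
    refine (lebesgueNormENN_const_mul_le hp hβ ENNReal.ofReal_ne_top).trans_lt
      (ENNReal.mul_lt_top ENNReal.ofReal_lt_top ?_)
    exact (lebesgueNormENN_div_bdist_le hΩ hfr hp hc hc1 hβ _).trans_lt
      (ENNReal.mul_lt_top ENNReal.ofReal_lt_top hun)
  have hexh := fun y hy => eventually_whitneyBall_subset (Ω := Ω) (y := y) hΩ hfr hc1 R hy
  have t1 := tendsto_lebesgueNormENN_of_exhaustion hΩ hfr hp hc1 hβ hKm hexh hgm hgn
  have t2 := tendsto_lebesgueNormENN_of_exhaustion hΩ hfr hp hc1 hβ hKm hexh hum hun.ne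
  obtain ⟨k, hk1, hk2⟩ := ((t1.eventually_lt_const hε).and (t2.eventually_lt_const hε)).exists
  obtain ⟨η, hη, hηb, hη1, hηf⟩ := hC (1 / ((k : ℝ) + 1)) (R + k) (by positivity) (by simp)
  have hη1' : ∀ z ∈ K k, η z = 1 := fun z hz => hη1 z hz.1 hz.2.1 hz.2.2
  have hn : ∀ z, ‖1 - η z‖ₑ ≤ 1 := fun z => by
    rw [← ofReal_norm, Real.norm_of_nonneg (sub_nonneg.2 (hηb z).2),
      ENNReal.ofReal_le_one]
    linarith [(hηb z).1]
  -- Openness of `K k` makes `η` constant near `z`, so both errors live on the complement of `K k`.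
  have hgrad : ∀ z ∈ K k, gradient η z = 0 := fun z hz => by
    have he : η =ᶠ[𝓝 z] fun _ => 1 := by
      filter_upwards [(hKo k).mem_nhds hz] with x hx using hη1' x hx
    rw [← norm_eq_zero, norm_gradient, he.fderiv_eq]
    simp
  refine ⟨η, hη, ?_, ?_⟩
  · refine (lebesgueNormENN_mono_ae hΩ hfr hp hc1 hβ ?_).trans_lt hk1
    filter_upwards [ae_restrict_mem hΩ.measurableSet] with z hz
    by_cases hzK : z ∈ K k
    · simp [hη1' z hzK, hgrad z hzK]
    · rw [indicator_of_mem (by exact hzK)]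
      have e : (G - fun x => η x • G x + u x • gradient η x) z =
          (1 - η z) • G z - u z • gradient η z := by
        simp only [Pi.sub_apply, sub_smul, one_smul]
        abel
      rw [e]
      refine (enorm_sub_le).trans ?_
      rw [enorm_smul, enorm_smul]
      refine add_le_add (mul_le_of_le_one_left' (hn z)) ?_
      rw [hq, mul_comm, ← mul_assoc, ← ENNReal.ofReal_mul hC0]
      gcongr
      rw [← ofReal_norm, norm_gradient]
      exact ENNReal.ofReal_le_ofReal (hηf z hz)
  · refine (lebesgueNormENN_mono_ae hΩ hfr hp hc1 hβ ?_).trans_lt hk2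
    refine Eventually.of_forall fun z => ?_
    by_cases hzK : z ∈ K k
    · simp [hη1' z hzK]
    · rw [indicator_of_mem (by exact hzK)]
      have e : (u - fun x => η x • u x) z = (1 - η z) • u z := by
        simp only [Pi.sub_apply, sub_smul, one_smul]
      rw [e, enorm_smul]
      exact mul_le_of_le_one_left' (hn z)

theorem lebesgueNorm_sub_le {F : Type*} [NormedAddCommGroup F] (hΩ : IsOpen Ω)
    (hfr : (frontier Ω).Nonempty) {d p c β s : ℝ} (hp : 1 ≤ p) (hc1 : c < 1) (hβ : 1 ≤ β)
    {f g h : E n → F} (hf : AEStronglyMeasurable f (volume.restrict Ω))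
    (hg : AEStronglyMeasurable g (volume.restrict Ω))
    (hh : AEStronglyMeasurable h (volume.restrict Ω)) :
    lebesgueNorm Ω d p c β s (f - h) ≤
      lebesgueNorm Ω d p c β s (f - g) + lebesgueNorm Ω d p c β s (g - h) := by
  refine le_trans ?_ (lebesgueNormENN_add_le hΩ hfr hp hc1 hβ (hf.sub hg).enorm (hg.sub hh).enorm)
  refine lebesgueNormENN_mono_ae hΩ hfr hp hc1 hβ (Eventually.of_forall fun z => ?_)
  have : (f - h) z = (f - g) z + (g - h) z := by simp
  rw [this]
  exact enorm_add_le _ _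

theorem MemTraceless.exists_testFunction_near (hΩ : IsOpen Ω) (hfr : (frontier Ω).Nonempty)
    {d p c β s : ℝ} (hp : 1 ≤ p) (hc : 0 < c) (hc1 : c < 1) (hβ : 1 ≤ β) {u : E n → ℝ}
    (hu : MemTraceless Ω d p c β s u) {ε : ℝ} (hε : 0 < ε) :
    ∃ φ : E n → ℝ, IsTestFunction Ω φ ∧
      tracelessNorm Ω d p c β s (u - φ) < ENNReal.ofReal ε := by
  obtain ⟨G, hG, hGL, hGn⟩ := hu.1.exists_weakGradient hΩ
  have hε4 : 0 < ENNReal.ofReal (ε / 4) := ENNReal.ofReal_pos.2 (by positivity)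
  obtain ⟨η, hη, h1, h2⟩ := exists_cutoff_near hΩ hfr hp hc hc1 hβ hG hGn hu.2.2 hε4
  have hw := hG.mul_testFunction hη
  obtain ⟨φ, hφ, h3, h4⟩ := exists_testFunction_near_of_compactSupport (d := d) (p := p) (s := s)
    hΩ hfr hp hc hc1 hβ hη.compact hη.subset hw (hη.memLp_smul hu.2.1)
    ((hη.memLp_smul hGL).add (hη.memLp_smul_gradient hu.2.1))
    (fun x hx => by
      by_contra h
      exact hx (by simp [image_eq_zero_of_notMem_tsupport h]))
    (fun x hx => by
      by_contra h
      exact hx (by simp [image_eq_zero_of_notMem_tsupport h,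
        gradient_eq_zero_of_notMem_tsupport h]))
    hε4.ne'
  have hφw : HasWeakGradient Ω φ (gradient φ) := hasWeakGradient_of_contDiff hφ.smooth
  refine ⟨φ, hφ, ?_⟩
  -- The difference `G - ∇φ` competes in the infimum. Inserting `ηu` and its weak gradient splits
  -- the norm into four errors, each below `ε / 4`.
  have hs1 : sobolevNorm Ω d p c β s (u - φ) ≤ _ :=
    (iInf₂_le (G - gradient φ) (hG.sub hφw)).trans
      (lebesgueNorm_sub_le hΩ hfr hp hc1 hβ hG.integrable_grad.aestronglyMeasurable
        (locallyIntegrableOn_univ.1 hw.integrable_grad).aestronglyMeasurable.restrict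
        hφw.integrable_grad.aestronglyMeasurable)
  have hs2 : lebesgueNorm Ω d p c β (s + 1) (u - φ) ≤ _ :=
    lebesgueNorm_sub_le hΩ hfr hp hc1 hβ hG.integrable.aestronglyMeasurable
      (locallyIntegrableOn_univ.1 hw.integrable).aestronglyMeasurable.restrict
      hφw.integrable.aestronglyMeasurable
  calc tracelessNorm Ω d p c β s (u - φ) ≤ _ := add_le_add hs1 hs2
    _ < (ENNReal.ofReal (ε / 4) + ENNReal.ofReal (ε / 4)) +
        (ENNReal.ofReal (ε / 4) + ENNReal.ofReal (ε / 4)) :=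
      ENNReal.add_lt_add (ENNReal.add_lt_add h1 h3) (ENNReal.add_lt_add h2 h4)
    _ = ENNReal.ofReal ε := by
      rw [← ENNReal.ofReal_add (by positivity) (by positivity),
        ← ENNReal.ofReal_add (by positivity) (by positivity)]
      congr 1
      ring

end Approximation

end AveragedSobolev

theorem mainTheorem9 {n : ℕ} (Ω : Set (AveragedSobolev.E n)) (d : ℝ)
    (hΩ : IsWeakLocalJohnDomain Ω d) (hcompl : ¬ Bornology.IsBounded Ωᶜ)
    (s p c β : ℝ) (hs : 0 < s) (hp : 1 ≤ p) (hc : 0 < c) (hc1 : c < 1) (hβ : 1 ≤ β) :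
    (∀ φ : AveragedSobolev.E n → ℝ, IsTestFunction Ω φ → MemTraceless Ω d p c β s φ) ∧
    ∀ u : AveragedSobolev.E n → ℝ, MemTraceless Ω d p c β s u →
      ∀ ε : ℝ, 0 < ε → ∃ φ : AveragedSobolev.E n → ℝ, IsTestFunction Ω φ ∧
        tracelessNorm Ω d p c β s (u - φ) < ENNReal.ofReal ε :=
  ⟨fun _ hφ => hφ.memTraceless hΩ.1 hΩ.2.2.2.1.1 hp hc hc1 hβ,
    fun _ hu _ hε => hu.exists_testFunction_near hΩ.1 hΩ.2.2.2.1.1 hp hc hc1 hβ hε⟩
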